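/- Let $I\subseteq\mathbb R$ be an open interval with $0\in I$. Consider the one-dimensional Gross–Pitaevskii equation $$ i\,\partial_t q+\partial_{xx}q-2(|q|^2-1)q=0,\qquad q=q(t,x)\in\mathbb C,\quad (t,x)\in I\times\mathbb R. \tag{GP}$$ Write $\dot H^1$ for the space of locally integrable $f:\mathbb R\to\mathbb C$ with weak derivative in $L^2(\mathbb R)$, with seminorm $\|f\|_{\dot H^1}=\|\partial_x f\|_{L^2(\mathbb R)}$, and write $L^\infty=L^\infty(\mathbb R;\mathbb C)$, $L^2_{\mathrm{loc}}=L^2_{\mathrm{loc}}(\mathbb R;\mathbb C)$. Let $q_0\in L^\infty\cap\dot H^1$ and let $q_1,q_2\in C(I;L^2_{\mathrm{loc}})\cap L^\infty(I;L^\infty\cap\dot H^1)$; that is, for every compact $K\subset\mathbb R$ the map $t\mapsto q_j(t)|_K\in L^2(K)$ is continuous on $I$, and $\operatorname{ess\,sup}_{t\in I}\big(\|q_j(t)\|_{L^\infty}+\|q_j(t)\|_{\dot H^1}\big)<\infty$. Suppose that $q_1$ and $q_2$ both solve (GP) in the sense of distributions on $I\times\mathbb R$, i.e. for every $\varphi\in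 C_c^\infty(I\times\mathbb R;\mathbb C)$ $$\int_{I\times\mathbb R} q_j\,\big(-i\,\partial_t\varphi+\partial_{xx}\varphi\big)-2(|q_j|^2-1)\,q_j\,\varphi\;\mathrm d(t,x)=0,$$ and that $q_1(0)=q_2(0)=q_0$. Then $q_1=q_2$, i.e. for every $t\in I$, $q_1(t)=q_2(t)$ almost everywhere on $\mathbb R$. -/

import Mathlib

open MeasureTheory Filter Topology TopologicalSpace
open scoped ENNReal NNReal Distributions

noncomputable section

namespace GrossPitaevskii

/-- Measurable functions `ℝ → ℂ` modulo equality almost everywhere. -/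
abbrev Wave : Type := ℝ →ₘ[volume] ℂ

/-- `g` is the weak (distributional) derivative of `f` on `ℝ`. -/
def HasWeakDeriv (f g : Wave) : Prop :=
  LocallyIntegrable f volume ∧ LocallyIntegrable g volume ∧
    ∀ φ : 𝓓((⊤ : Opens ℝ), ℂ), ∫ x, f x * deriv φ x = - ∫ x, g x * φ x

/-- The homogeneous Sobolev seminorm `‖∂ₓ f‖_{L²}`, with value `∞` when `f` has no locally
integrable weak derivative. The weak derivative is unique, so the infimum is over at most one
element. -/
def hDotOneSeminorm (f : Wave) : ℝ≥0∞ :=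
  ⨅ (g : Wave) (_ : HasWeakDeriv f g), eLpNorm g 2 volume

/-- `f ∈ L^∞ ∩ Ḣ¹`. -/
def MemLinftyHDotOne (f : Wave) : Prop :=
  eLpNorm f ∞ volume < ∞ ∧ hDotOneSeminorm f < ∞

/-- `q ∈ C(I; L²_loc)`: the values are square integrable on compact sets, and `q` is continuous
for the seminorms `‖·‖_{L²(K)}`, `K` compact. -/
def ContinuousL2loc (I : Opens ℝ) (q : ℝ → Wave) : Prop :=
  ∀ K : Set ℝ, IsCompact K →
    (∀ t ∈ I, MemLp (q t) 2 (volume.restrict K)) ∧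
    ∀ t₀ ∈ I, Tendsto (fun t => eLpNorm (q t - q t₀ : Wave) 2 (volume.restrict K))
      (𝓝[(I : Set ℝ)] t₀) (𝓝 0)

/-- `q ∈ L^∞(I; L^∞ ∩ Ḣ¹)`: both norms of `q(t)` are essentially bounded in `t ∈ I`. -/
def BoundedLinftyHDotOne (I : Opens ℝ) (q : ℝ → Wave) : Prop :=
  ∃ M : ℝ≥0, ∀ᵐ t ∂(volume.restrict (I : Set ℝ)),
    eLpNorm (q t) ∞ volume ≤ M ∧ hDotOneSeminorm (q t) ≤ M

/-- The space-time domain `I × ℝ`, points written `(t, x)`. -/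
def slab (I : Opens ℝ) : Opens (ℝ × ℝ) :=
  ⟨(I : Set ℝ) ×ˢ Set.univ, I.isOpen.prod isOpen_univ⟩

/-- `u : ℝ × ℝ → ℂ`, a function of `(t, x)`, solves `i ∂ₜ u + ∂ₓₓ u - 2 (|u|² - 1) u = 0`
in the sense of distributions on `I × ℝ`. -/
def SolvesGPWeakly (I : Opens ℝ) (u : ℝ × ℝ → ℂ) : Prop :=
  LocallyIntegrableOn u (slab I : Set (ℝ × ℝ)) volume ∧
  LocallyIntegrableOn (fun p => 2 * ((‖u p‖ : ℂ) ^ 2 - 1) * u p)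
    (slab I : Set (ℝ × ℝ)) volume ∧
  ∀ φ : 𝓓(slab I, ℂ),
    ∫ p in (slab I : Set (ℝ × ℝ)),
      (u p * (- Complex.I * deriv (fun s => φ (s, p.2)) p.1
          + iteratedDeriv 2 (fun y => φ (p.1, y)) p.2)
        - 2 * ((‖u p‖ : ℂ) ^ 2 - 1) * u p * φ p) = 0

/-- The curve `t ↦ q(t)` is a distributional solution on `I × ℝ`: the function of `(t, x)` that
it defines (unique up to a null set of `I × ℝ`) solves the equation. -/
def IsDistributionalSolution (I : Opens ℝ) (q : ℝ → Wave) : Prop :=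
  ∃ u : ℝ × ℝ → ℂ,
    (∀ᵐ t ∂(volume.restrict (I : Set ℝ)), (fun x => u (t, x)) =ᵐ[volume] q t) ∧
    SolvesGPWeakly I u

end GrossPitaevskii

end

/-! The difference `w = q₁ - q₂` satisfies `i wₜ + wₓₓ = N(q₁) - N(q₂)`, where the nonlinearity `N`
is Lipschitz on bounded sets, so formally an `L²` estimate and Gronwall's inequality give `w = 0`.
There are two obstacles: `w` need not lie in `L²(ℝ)`, and it is too rough for `|w|²` to be
differentiated.

The first is met by the weight `χ(x) = 1 / (1 + (δx)²)`, which satisfies `|χ'| ≤ δχ`. After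
integration by parts the dispersive term leaves only `∫ χ' ⟨w, i wₓ⟩`, which is at most `δ ‖w‖_∞
‖χ‖_{L²} ‖wₓ‖_{L²} = O(√δ)`. The second is met by averaging in space at scale `ε`: tested against
the kernel, the equation becomes an ordinary differential equation in time at each point
(`IsDistributionalSolution.hasDerivAt_conv`). Averaging does not commute with `N`, but functions in
`Ḣ¹` are Hölder continuous of exponent `1/2` (`HasWeakDeriv.ae_norm_sub_le`), so the pointwise error
is `O(√ε)` (`ae_mollified_sub_le`) and contributes `O(√ε / δ)` to the weighted energy.

With `ε = δ⁴` both errors vanish as `δ → 0`. The differential inequality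
`abs_integral_weight_inner_le` and Gronwall's `le_of_abs_deriv_le` then force `w(t) = 0` at almost
every time, and `L²_loc` continuity extends this to every time. -/

namespace GrossPitaevskii

open scoped ContDiff

/-! ### Weak derivatives in time on an interval. -/

/-- A smooth function of compact support in an interval and of mean zero has a primitive of the
same kind. -/
theorem exists_primitive_of_integral_eq_zero {I : Set ℝ} (hI : I.OrdConnected) {ψ : ℝ → ℝ}
    (hψ : ContDiff ℝ ∞ ψ) (hc : HasCompactSupport ψ) (hs : tsupport ψ ⊆ I)
    (h0 : ∫ x, ψ x = 0) :
    ∃ θ : ℝ → ℝ, ContDiff ℝ ∞ θ ∧ HasCompactSupport θ ∧ tsupport θ ⊆ I ∧ deriv θ = ψ := by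
  rcases (tsupport ψ).eq_empty_or_nonempty with he | hne
  · have : ψ = 0 := tsupport_eq_empty_iff.1 he
    refine ⟨0, contDiff_const, HasCompactSupport.zero, by simp, ?_⟩
    rw [this]; ext x; simp
  obtain ⟨a, ha, ha'⟩ := hc.isCompact.exists_isLeast hne
  obtain ⟨b, hb, hb'⟩ := hc.isCompact.exists_isGreatest hne
  have hsub : tsupport ψ ⊆ Set.Icc a b := fun x hx => ⟨ha' hx, hb' hx⟩
  have hzero : ∀ x, x ∉ Set.Icc a b → ψ x = 0 := fun x hx =>
    image_eq_zero_of_notMem_tsupport fun h => hx (hsub h)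
  -- Starting at `a - 1` instead of `a` puts the whole closed support, left endpoint included,
  -- inside the half-open interval of integration once `x` exceeds `b`.
  have hd : ∀ x, HasDerivAt (fun x => ∫ t in (a - 1)..x, ψ t) (ψ x) x := fun x =>
    intervalIntegral.integral_hasDerivAt_right (hψ.continuous.intervalIntegrable _ _)
      (hψ.continuous.stronglyMeasurableAtFilter _ _) hψ.continuous.continuousAt
  have hd' : deriv (fun x => ∫ t in (a - 1)..x, ψ t) = ψ := funext fun x => (hd x).deriv
  have hsupp : Function.support (fun x => ∫ t in (a - 1)..x, ψ t) ⊆ Set.Icc a b := by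
    intro x hx
    by_contra hx'
    apply hx
    rw [Set.mem_Icc, not_and_or, not_le, not_le] at hx'
    rcases hx' with h | h
    · refine (intervalIntegral.integral_congr (g := fun _ => 0) fun t ht => hzero t ?_).trans
        (by simp)
      intro h'
      have := (Set.mem_uIcc.1 ht)
      rcases this with h1 | h1 <;> linarith [h1.1, h1.2, h'.1]
    · refine (intervalIntegral.integral_eq_integral_of_support_subset ?_).trans h0
      intro t ht
      have := hsub (subset_tsupport _ ht)
      exact ⟨by linarith [this.1], by linarith [this.2]⟩
  refine ⟨_, ?_, HasCompactSupport.intro (isCompact_Icc (a := a) (b := b)) fun x hx => ?_, ?_,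
    hd'⟩
  · rw [contDiff_infty_iff_deriv, hd']
    exact ⟨fun x => (hd x).differentiableAt, hψ⟩
  · by_contra h
    exact hx (hsupp h)
  · exact (closure_minimal hsupp isClosed_Icc).trans (hI.out (hs ha) (hs hb))

/-- The product of a continuous function of compact support in an open set and a function
continuous there is integrable. -/
theorem integrable_smul_of_tsupport_subset {I : Set ℝ} (hIo : IsOpen I) {g : ℝ → ℝ} {c : ℝ → ℂ}
    (hg : Continuous g) (hgc : HasCompactSupport g) (hgs : tsupport g ⊆ I)
    (hcont : ContinuousOn c I) : Integrable (fun t => g t • c t) := by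
  refine Continuous.integrable_of_hasCompactSupport ?_ hgc.smul_right
  refine continuous_iff_continuousAt.2 fun x => ?_
  by_cases hx : x ∈ I
  · exact (hg.continuousOn.smul hcont).continuousAt (hIo.mem_nhds hx)
  · have : (fun t => g t • c t) =ᶠ[𝓝 x] fun _ => 0 := by
      have h1 : ∀ᶠ t in 𝓝 x, t ∉ tsupport g :=
        (isClosed_tsupport g).isOpen_compl.mem_nhds fun h => hx (hgs h)
      filter_upwards [h1] with t ht
      simp [image_eq_zero_of_notMem_tsupport ht]
    exact this.continuousAt

/-- Continuous functions with vanishing weak derivative on an open interval are constant. -/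
theorem eqOn_const_of_weakDeriv_eq_zero {I : Set ℝ} (hI : I.OrdConnected) (hIo : IsOpen I)
    {t₀ : ℝ} (ht₀ : t₀ ∈ I) {c : ℝ → ℂ} (hcont : ContinuousOn c I)
    (hw : ∀ θ : ℝ → ℝ, ContDiff ℝ ∞ θ → HasCompactSupport θ → tsupport θ ⊆ I →
      ∫ t, deriv θ t • c t = 0) :
    ∃ κ : ℂ, Set.EqOn c (fun _ => κ) I := by
  obtain ⟨r, hr, hrI⟩ := Metric.isOpen_iff.1 hIo t₀ ht₀
  let φ : ContDiffBump t₀ := ⟨r / 4, r / 2, by positivity, by linarith⟩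
  set ψ₀ : ℝ → ℝ := φ.normed volume with hψ₀
  have hψ₀s : tsupport ψ₀ ⊆ I := by
    rw [hψ₀, φ.tsupport_normed_eq]
    exact (Metric.closedBall_subset_ball (by change r / 2 < r; linarith)).trans hrI
  have hψ₀c : HasCompactSupport ψ₀ := φ.hasCompactSupport_normed
  have hψ₀d : ContDiff ℝ ∞ ψ₀ := φ.contDiff_normed
  have hint : ∀ g : ℝ → ℝ, ContDiff ℝ ∞ g → HasCompactSupport g → tsupport g ⊆ I →
      Integrable (fun t => g t • c t) := fun g hg hgc hgs =>
    integrable_smul_of_tsupport_subset hIo hg.continuous hgc hgs hcont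
  refine ⟨∫ t, ψ₀ t • c t, ?_⟩
  set κ := ∫ t, ψ₀ t • c t
  have key := hIo.ae_eq_zero_of_integral_contDiff_smul_eq_zero (μ := volume)
    (f := fun t => c t - κ) ((hcont.sub continuousOn_const).locallyIntegrableOn
      hIo.measurableSet) ?_
  · have h2 : c =ᵐ[volume.restrict I] fun _ => κ := by
      rw [Filter.EventuallyEq, ae_restrict_iff' hIo.measurableSet]
      filter_upwards [key] with x hx hxI
      exact sub_eq_zero.1 (hx hxI)
    exact Measure.eqOn_open_of_ae_eq h2 hIo hcont continuousOn_const
  · intro g hg hgc hgs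
    have hg0 : Integrable g := hg.continuous.integrable_of_hasCompactSupport hgc
    have hψ₀i : Integrable ψ₀ := φ.integrable_normed
    -- Subtracting the multiple of `ψ₀` with the same integral makes `g` a function of mean zero,
    -- hence a derivative `deriv θ` to which `hw` applies.
    have hs' : tsupport (fun t => g t - (∫ s, g s) * ψ₀ t) ⊆ I :=
      (tsupport_sub _ _).trans (Set.union_subset hgs (tsupport_mul_subset_right.trans hψ₀s))
    have h0 : ∫ t, (g t - (∫ s, g s) * ψ₀ t) = 0 := by
      rw [integral_sub hg0 (hψ₀i.const_mul _), integral_const_mul, hψ₀, φ.integral_normed]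
      simp
    obtain ⟨θ, hθ, hθc, hθs, hθd⟩ := exists_primitive_of_integral_eq_zero hI
      (hg.sub (contDiff_const.mul hψ₀d)) (hgc.sub hψ₀c.mul_left) hs' h0
    have h1 := hw θ hθ hθc hθs
    rw [hθd] at h1
    have h2 : ∀ t, (g t - (∫ s, g s) * ψ₀ t) • c t
        = g t • c t - (∫ s, g s) • (ψ₀ t • c t) := fun t => by
      rw [sub_smul, mul_smul]
    simp_rw [h2] at h1
    have h3 : Integrable (fun t => (∫ s, g s) • (ψ₀ t • c t)) :=
      (hint ψ₀ hψ₀d hψ₀c hψ₀s).smul (∫ s, g s)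
    rw [integral_sub (hint g hg hgc hgs) h3, integral_smul] at h1
    simp_rw [smul_sub]
    rw [integral_sub (hint g hg hgc hgs) (hg0.smul_const κ), integral_smul_const]
    exact h1

/-- A continuous function with a continuous weak derivative on an open interval is classically
differentiable. -/
theorem hasDerivAt_of_weakDeriv {I : Set ℝ} (hI : I.OrdConnected) (hIo : IsOpen I)
    {a b : ℝ → ℂ} (ha : ContinuousOn a I) (hb : ContinuousOn b I)
    (hw : ∀ θ : ℝ → ℝ, ContDiff ℝ ∞ θ → HasCompactSupport θ → tsupport θ ⊆ I →
      ∫ t, deriv θ t • a t = - ∫ t, θ t • b t) {t : ℝ} (ht : t ∈ I) :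
    HasDerivAt a (b t) t := by
  have hB : ∀ s ∈ I, HasDerivAt (fun s => ∫ r in t..s, b r) (b s) s := fun s hs =>
    intervalIntegral.integral_hasDerivAt_right
      ((hb.mono (hI.uIcc_subset ht hs)).intervalIntegrable)
      (hb.stronglyMeasurableAtFilter hIo s hs) (hb.continuousAt (hIo.mem_nhds hs))
  set B : ℝ → ℂ := fun s => ∫ r in t..s, b r
  have hBc : ContinuousOn B I := fun s hs => (hB s hs).continuousAt.continuousWithinAt
  obtain ⟨κ, hκ⟩ := eqOn_const_of_weakDeriv_eq_zero hI hIo ht (ha.sub hBc) fun θ hθ hθc hθs => by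
    have hθ'c : Continuous (deriv θ) := hθ.continuous_deriv (by simp)
    have hθ's : tsupport (deriv θ) ⊆ I := tsupport_deriv_subset.trans hθs
    have i1 := integrable_smul_of_tsupport_subset hIo hθ'c hθc.deriv hθ's ha
    have i2 := integrable_smul_of_tsupport_subset hIo hθ'c hθc.deriv hθ's hBc
    have i3 := integrable_smul_of_tsupport_subset hIo hθ.continuous hθc hθs hb
    have i4 := integrable_smul_of_tsupport_subset hIo hθ.continuous hθc hθs hBc
    have h3 : ∫ s, (θ s • b s + deriv θ s • B s) = 0 := by
      refine integral_eq_zero_of_hasDerivAt_of_integrable (f := fun s => θ s • B s)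
        (fun s => ?_) (i3.add i2) i4
      by_cases hs : s ∈ I
      · exact ((hθ.differentiable (by simp) s).hasDerivAt.smul (hB s hs))
      -- Nothing is known about `B` outside `I`, but there the product vanishes near `s`.
      · have h1 : ∀ᶠ t in 𝓝 s, t ∉ tsupport θ :=
          (isClosed_tsupport θ).isOpen_compl.mem_nhds fun h => hs (hθs h)
        have : (fun t => θ t • B t) =ᶠ[𝓝 s] fun _ => 0 := by
          filter_upwards [h1] with t ht
          simp [image_eq_zero_of_notMem_tsupport ht]
        have h4 : θ s • b s + deriv θ s • B s = 0 := by
          rw [image_eq_zero_of_notMem_tsupport h1.self_of_nhds,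
            image_eq_zero_of_notMem_tsupport fun h => hs (hθ's h)]
          simp
        rw [h4]
        exact (hasDerivAt_const s (0 : ℂ)).congr_of_eventuallyEq this
    rw [integral_add i3 i2] at h3
    have : ∀ s, deriv θ s • (a - B) s = deriv θ s • a s - deriv θ s • B s := fun s => smul_sub _ _ _
    simp_rw [this]
    rw [integral_sub i1 i2, hw θ hθ hθc hθs]
    linear_combination -h3
  have h5 : a =ᶠ[𝓝 t] fun s => B s + κ := by
    filter_upwards [hIo.mem_nhds ht] with s hs
    have := hκ hs
    simp only [Pi.sub_apply] at this
    rw [← this]; ring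
  exact ((hB t ht).add_const κ).congr_of_eventuallyEq h5

/-! ### Convolution, averaging kernels and Hölder continuity in space. -/

/-- Convolution of complex valued functions on the line. -/
noncomputable def conv (f k : ℝ → ℂ) (x : ℝ) : ℂ := ∫ y, f y * k (x - y)

theorem hasDerivAt_conv {f k : ℝ → ℂ} (hf : LocallyIntegrable f) (hk : ContDiff ℝ ∞ k)
    (hc : HasCompactSupport k) (x : ℝ) : HasDerivAt (conv f k) (conv f (deriv k) x) x :=
  hc.hasDerivAt_convolution_right (ContinuousLinearMap.mul ℝ ℂ) hf (hk.of_le (by simp)) x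

theorem continuous_conv {f k : ℝ → ℂ} (hf : LocallyIntegrable f) (hk : Continuous k)
    (hc : HasCompactSupport k) : Continuous (conv f k) :=
  hc.continuous_convolution_right (ContinuousLinearMap.mul ℝ ℂ) hf hk

theorem integrable_mul_comp_sub_left {f k : ℝ → ℂ} (hf : LocallyIntegrable f) (hk : Continuous k)
    (hc : HasCompactSupport k) (x : ℝ) : Integrable fun y => f y * k (x - y) :=
  hc.convolutionExists_right (ContinuousLinearMap.mul ℝ ℂ) hf hk x

theorem conv_sub_left {f g k : ℝ → ℂ} (hf : LocallyIntegrable f) (hg : LocallyIntegrable g)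
    (hk : Continuous k) (hc : HasCompactSupport k) (x : ℝ) :
    conv (fun y => f y - g y) k x = conv f k x - conv g k x := by
  unfold conv
  rw [← integral_sub (integrable_mul_comp_sub_left hf hk hc x)
    (integrable_mul_comp_sub_left hg hk hc x)]
  simp_rw [sub_mul]

theorem norm_conv_le {f k : ℝ → ℂ} {M : ℝ} (hf : ∀ᵐ y, ‖f y‖ ≤ M) (hk : Continuous k)
    (hc : HasCompactSupport k) (x : ℝ) : ‖conv f k x‖ ≤ M * ∫ z, ‖k z‖ := by
  have hi : Integrable k := hk.integrable_of_hasCompactSupport hc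
  rw [← integral_sub_left_eq_self (fun z => ‖k z‖) volume x, ← integral_const_mul]
  refine norm_integral_le_of_norm_le ((hi.comp_sub_left x).norm.const_mul M) ?_
  filter_upwards [hf] with y hy
  rw [norm_mul]
  gcongr

/-- Convolution moves the weak derivative onto the kernel. -/
theorem HasWeakDeriv.conv_deriv {f g : Wave} (h : HasWeakDeriv f g) {k : ℝ → ℂ}
    (hk : ContDiff ℝ ∞ k) (hc : HasCompactSupport k) (x : ℝ) :
    conv f (deriv k) x = conv g k x := by
  have hc' : HasCompactSupport fun y => k (x - y) :=
    hc.comp_homeomorph (Homeomorph.subLeft x)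
  have := h.2.2 ⟨fun y => k (x - y), hk.comp (contDiff_const.sub contDiff_id), hc', by simp⟩
  simp only [TestFunction.coe_mk, deriv_comp_const_sub, mul_neg, integral_neg, neg_inj] at this
  exact this

/-- A weighted `L¹` bound for convolutions, from Minkowski's and Hölder's inequalities. -/
theorem lintegral_mul_conv_le {c : ℝ → ℝ≥0∞} (hc : Measurable c) {g k : ℝ → ℂ}
    (hg : Measurable g) (hk : Measurable k) :
    ∫⁻ x, c x * ‖conv g k x‖ₑ ≤
      (∫⁻ z, ‖k z‖ₑ) * ((∫⁻ x, c x ^ (2 : ℝ)) ^ (1 / 2 : ℝ) * eLpNorm g 2 volume) := by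
  have h1 : ∀ x, ‖conv g k x‖ₑ ≤ ∫⁻ z, ‖g (x - z)‖ₑ * ‖k z‖ₑ := fun x => by
    refine (enorm_integral_le_lintegral_enorm _).trans_eq ?_
    rw [← lintegral_sub_left_eq_self _ x]
    simp [enorm_mul]
  calc ∫⁻ x, c x * ‖conv g k x‖ₑ
      ≤ ∫⁻ x, ∫⁻ z, c x * (‖g (x - z)‖ₑ * ‖k z‖ₑ) := by
        refine lintegral_mono fun x => ?_
        rw [lintegral_const_mul _ (by fun_prop)]
        gcongr
        exact h1 x
    _ = ∫⁻ z, ∫⁻ x, c x * (‖g (x - z)‖ₑ * ‖k z‖ₑ) := by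
        rw [lintegral_lintegral_swap]
        refine Measurable.aemeasurable ?_
        simp only [Function.uncurry_def]
        fun_prop
    _ ≤ ∫⁻ z, ‖k z‖ₑ * ((∫⁻ x, c x ^ (2 : ℝ)) ^ (1 / 2 : ℝ) * eLpNorm g 2 volume) := by
        refine lintegral_mono fun z => ?_
        have h2 : ∀ x, c x * (‖g (x - z)‖ₑ * ‖k z‖ₑ)
            = ‖k z‖ₑ * ((c * fun x => ‖g (x - z)‖ₑ) x) := fun x => by
          simp only [Pi.mul_apply]; ring
        simp_rw [h2]
        rw [lintegral_const_mul _ (by fun_prop)]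
        gcongr
        refine (ENNReal.lintegral_mul_le_Lp_mul_Lq volume Real.HolderConjugate.two_two
          hc.aemeasurable (by fun_prop)).trans_eq ?_
        congr 1
        rw [lintegral_sub_right_eq_self (fun x => ‖g x‖ₑ ^ (2 : ℝ)),
          eLpNorm_eq_lintegral_rpow_enorm_toReal (by simp) (by simp)]
        simp
    _ = _ := lintegral_mul_const _ (by fun_prop)

/-- The smooth averaging kernel attached to a bump function. -/
noncomputable def bumpKernel (φ : ContDiffBump (0 : ℝ)) (x : ℝ) : ℂ := (φ.normed volume x : ℂ)

section bumpKernel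

variable (φ : ContDiffBump (0 : ℝ))

theorem contDiff_bumpKernel : ContDiff ℝ ∞ (bumpKernel φ) :=
  Complex.ofRealCLM.contDiff.comp φ.contDiff_normed

theorem hasCompactSupport_bumpKernel : HasCompactSupport (bumpKernel φ) :=
  φ.hasCompactSupport_normed.comp_left Complex.ofReal_zero

theorem norm_bumpKernel (x : ℝ) : ‖bumpKernel φ x‖ = φ.normed volume x := by
  rw [bumpKernel, Complex.norm_real, Real.norm_of_nonneg (φ.nonneg_normed x)]

theorem integral_norm_bumpKernel : ∫ x, ‖bumpKernel φ x‖ = 1 := by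
  simp_rw [norm_bumpKernel]
  exact φ.integral_normed

theorem lintegral_enorm_bumpKernel : ∫⁻ x, ‖bumpKernel φ x‖ₑ = 1 := by
  rw [← ofReal_integral_norm_eq_lintegral_enorm
    ((contDiff_bumpKernel φ).continuous.integrable_of_hasCompactSupport
      (hasCompactSupport_bumpKernel φ)), integral_norm_bumpKernel, ENNReal.ofReal_one]

theorem conv_bumpKernel (f : ℝ → ℂ) (x : ℝ) :
    conv f (bumpKernel φ) x
      = convolution (φ.normed volume) f (ContinuousLinearMap.lsmul ℝ ℝ) volume x := by
  unfold conv convolution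
  rw [← integral_sub_left_eq_self _ volume x]
  simp [bumpKernel, mul_comm]

theorem bumpKernel_eq_zero {x : ℝ} (hx : φ.rOut ≤ |x|) : bumpKernel φ x = 0 := by
  have : x ∉ Function.support (φ.normed volume) := by
    rw [φ.support_normed_eq]
    simpa using hx
  rw [bumpKernel, Function.notMem_support.1 this, Complex.ofReal_zero]

end bumpKernel

/-- Functions in `Ḣ¹(ℝ)` are Hölder continuous of exponent `1/2` up to a null set. -/
theorem HasWeakDeriv.ae_norm_sub_le {f g : Wave} (h : HasWeakDeriv f g) {G : ℝ≥0}
    (hG : eLpNorm g 2 volume ≤ G) :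
    ∃ s ∈ ae (volume : Measure ℝ), ∀ x ∈ s, ∀ y ∈ s, ‖f x - f y‖ ≤ G * √|x - y| := by
  -- Radii shrink to zero with fixed ratio `rOut = 2 * rIn`, as almost everywhere convergence of the
  -- averages requires. The full-measure set `s` is the set of points of convergence.
  let φ : ℕ → ContDiffBump (0 : ℝ) := fun n =>
    ⟨1 / (n + 1) / 2, 1 / (n + 1), by positivity, half_lt_self (by positivity)⟩
  have hlim := ContDiffBump.ae_convolution_tendsto_right_of_locallyIntegrable (φ := φ)
    (l := atTop) (K := 2) tendsto_one_div_add_atTop_nhds_zero_nat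
    (Eventually.of_forall fun n => by simp only [φ]; linarith) h.1
  refine ⟨_, hlim, fun x hx y hy => ?_⟩
  simp only [Set.mem_ofPred_eq, ← conv_bumpKernel] at hx hy
  refine le_of_tendsto (hx.sub hy).norm (Eventually.of_forall fun n => ?_)
  set k := bumpKernel (φ n)
  have hk := contDiff_bumpKernel (φ n)
  have hkc := hasCompactSupport_bumpKernel (φ n)
  have hd : ∀ z, HasDerivAt (conv f k) (conv g k z) z := fun z => by
    rw [← h.conv_deriv hk hkc]
    exact hasDerivAt_conv h.1 hk hkc z
  rw [← intervalIntegral.integral_eq_sub_of_hasDerivAt (fun z _ => hd z)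
    ((continuous_conv h.2.1 hk.continuous hkc).intervalIntegrable _ _),
    intervalIntegral.norm_intervalIntegral_eq]
  have h1 : ‖∫ z in Set.uIoc y x, conv g k z‖ₑ ≤ ENNReal.ofReal (G * √|x - y|) := by
    refine (enorm_integral_le_lintegral_enorm _).trans ?_
    -- With an indicator as weight, the factor `(∫ c²)^(1/2)` is the square root of the length of
    -- the interval, which yields the exponent `1/2` uniformly in `n`.
    have := lintegral_mul_conv_le (c := (Set.uIoc y x).indicator 1)
      (measurable_one.indicator measurableSet_uIoc) (g := g) (k := k)
      (AEEqFun.stronglyMeasurable g).measurable hk.continuous.measurable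
    rw [lintegral_enorm_bumpKernel, one_mul] at this
    rw [← lintegral_indicator measurableSet_uIoc]
    refine (lintegral_congr fun z => ?_).trans_le (this.trans ?_)
    · by_cases hz : z ∈ Set.uIoc y x <;> simp [hz]
    · have h2 : ∫⁻ z, (Set.uIoc y x).indicator (1 : ℝ → ℝ≥0∞) z ^ (2 : ℝ)
          = ENNReal.ofReal |x - y| := by
        rw [← Real.volume_uIoc, ← lintegral_indicator_one measurableSet_uIoc]
        refine lintegral_congr fun z => ?_
        by_cases hz : z ∈ Set.uIoc y x <;> simp [hz]
      rw [h2, ENNReal.ofReal_rpow_of_nonneg (abs_nonneg _) (by norm_num), ← Real.sqrt_eq_rpow,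
        mul_comm, ENNReal.ofReal_mul G.coe_nonneg, ENNReal.ofReal_coe_nnreal]
      gcongr
  rw [← ofReal_norm] at h1
  exact (ENNReal.ofReal_le_ofReal_iff (by positivity)).1 h1

/-! ### Continuity in time and uniform bounds. -/

/-- Continuity on `I` of a family of functions in each seminorm `‖·‖_{L²(K)}`, `K` compact. -/
def L2locContinuousOn (I : Set ℝ) (F : ℝ → ℝ → ℂ) : Prop :=
  ∀ K : Set ℝ, IsCompact K → ∀ t₀ ∈ I,
    Tendsto (fun t => eLpNorm (fun x => F t x - F t₀ x) 2 (volume.restrict K)) (𝓝[I] t₀) (𝓝 0)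

/-- Uniform essential boundedness of a family of measurable functions. -/
structure UniformlyBoundedOn (I : Set ℝ) (F : ℝ → ℝ → ℂ) (M : ℝ) : Prop where
  aestronglyMeasurable : ∀ t ∈ I, AEStronglyMeasurable (F t) volume
  ae_norm_le : ∀ t ∈ I, ∀ᵐ x, ‖F t x‖ ≤ M

theorem locallyIntegrable_of_ae_norm_le {f : ℝ → ℂ} {M : ℝ} (hf : AEStronglyMeasurable f volume)
    (hM : ∀ᵐ x, ‖f x‖ ≤ M) : LocallyIntegrable f :=
  (memLp_top_of_bound hf M hM).locallyIntegrable (by simp)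

theorem UniformlyBoundedOn.locallyIntegrable {I : Set ℝ} {F : ℝ → ℝ → ℂ} {M : ℝ}
    (h : UniformlyBoundedOn I F M) {t : ℝ} (ht : t ∈ I) : LocallyIntegrable (F t) :=
  locallyIntegrable_of_ae_norm_le (h.aestronglyMeasurable t ht) (h.ae_norm_le t ht)

/-- Only the values on the compact support of `y ↦ k (x - y)` enter, and there the `L²` norm
controls the `L¹` norm. This is the continuity that upgrades weak time derivatives of mollified
solutions to classical ones. -/
theorem continuousOn_conv_of_L2locContinuousOn {I : Set ℝ} {F : ℝ → ℝ → ℂ} {M : ℝ}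
    (hF : L2locContinuousOn I F) (hb : UniformlyBoundedOn I F M) {k : ℝ → ℂ} (hk : Continuous k)
    (hc : HasCompactSupport k) (x : ℝ) : ContinuousOn (fun t => conv (F t) k x) I := by
  intro t₀ ht₀
  have hc' : HasCompactSupport fun y => k (x - y) := hc.comp_homeomorph (Homeomorph.subLeft x)
  set K := tsupport fun y => k (x - y)
  have hK : IsCompact K := hc'
  have hset : ∀ f : ℝ → ℂ, conv f k x = ∫ y in K, f y * k (x - y) := fun f => by
    refine (setIntegral_eq_integral_of_forall_compl_eq_zero fun y hy => ?_).symm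
    rw [image_eq_zero_of_notMem_tsupport (f := fun y => k (x - y)) hy, mul_zero]
  obtain ⟨C, hC⟩ := hk.bounded_above_of_compact_support hc
  have hC0 : 0 ≤ C := (norm_nonneg _).trans (hC 0)
  have hi : ∀ t ∈ I, Integrable (fun y => F t y * k (x - y)) (volume.restrict K) := fun t ht =>
    (integrable_mul_comp_sub_left (hb.locallyIntegrable ht) hk hc x).integrableOn
  unfold ContinuousWithinAt
  simp_rw [hset]
  refine tendsto_integral_of_L1' _ (hi t₀ ht₀).aestronglyMeasurable
    (eventually_mem_nhdsWithin.mono hi) ?_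
  have hlim := ENNReal.Tendsto.const_mul (a := ENNReal.ofReal C)
    (ENNReal.Tendsto.mul_const (b := volume.restrict K Set.univ ^ (1 / (1 : ℝ≥0∞).toReal
      - 1 / (2 : ℝ≥0∞).toReal)) (hF K hK t₀ ht₀) (Or.inr ?_)) (Or.inr ENNReal.ofReal_ne_top)
  · rw [zero_mul, mul_zero] at hlim
    refine tendsto_of_tendsto_of_tendsto_of_le_of_le' tendsto_const_nhds hlim
      (Eventually.of_forall fun _ => zero_le) ?_
    filter_upwards [eventually_mem_nhdsWithin] with t ht
    have hm : AEStronglyMeasurable (fun y => F t y - F t₀ y) (volume.restrict K) :=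
      ((hb.aestronglyMeasurable t ht).sub (hb.aestronglyMeasurable t₀ ht₀)).restrict
    refine (eLpNorm_le_mul_eLpNorm_of_ae_le_mul (g := fun y => F t y - F t₀ y) (c := C)
      (Eventually.of_forall fun y => ?_) 1).trans ?_
    · simp only [Pi.sub_apply]
      rw [← sub_mul, norm_mul, mul_comm]
      gcongr
      exact hC _
    · gcongr
      exact eLpNorm_le_eLpNorm_mul_rpow_measure_univ (by norm_num) hm
  · refine ENNReal.rpow_ne_top_of_nonneg (by norm_num) ?_
    rw [Measure.restrict_apply_univ]
    exact hK.measure_lt_top.ne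

/-- The Gross–Pitaevskii nonlinearity. -/
noncomputable def nonlinearity (z : ℂ) : ℂ := 2 * ((‖z‖ : ℂ) ^ 2 - 1) * z

theorem continuous_nonlinearity : Continuous nonlinearity := by
  unfold nonlinearity
  fun_prop

/-- In the splitting `2(|a|² - 1)(a - b) + 2(|a|² - |b|²) b`, the first term contributes `2M² + 2`
to the constant and the second `4M²`. -/
theorem norm_nonlinearity_sub_le {M : ℝ} {a b : ℂ} (ha : ‖a‖ ≤ M) (hb : ‖b‖ ≤ M) :
    ‖nonlinearity a - nonlinearity b‖ ≤ (6 * M ^ 2 + 2) * ‖a - b‖ := by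
  have hM : 0 ≤ M := (norm_nonneg a).trans ha
  have h1 : nonlinearity a - nonlinearity b
      = ((2 * (‖a‖ ^ 2 - 1) : ℝ) : ℂ) * (a - b) + ((2 * (‖a‖ ^ 2 - ‖b‖ ^ 2) : ℝ) : ℂ) * b := by
    unfold nonlinearity
    push_cast
    ring
  have h2 : |2 * (‖a‖ ^ 2 - 1)| ≤ 2 * M ^ 2 + 2 := by
    rw [abs_le]
    have : ‖a‖ ^ 2 ≤ M ^ 2 := by gcongr
    constructor <;> nlinarith [sq_nonneg ‖a‖]
  have h3 : |2 * (‖a‖ ^ 2 - ‖b‖ ^ 2)| ≤ 4 * M * ‖a - b‖ := by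
    have h4 : |‖a‖ - ‖b‖| ≤ ‖a - b‖ := abs_norm_sub_norm_le a b
    rw [show 2 * (‖a‖ ^ 2 - ‖b‖ ^ 2) = 2 * (‖a‖ + ‖b‖) * (‖a‖ - ‖b‖) by ring, abs_mul,
      abs_of_nonneg (by positivity : (0 : ℝ) ≤ 2 * (‖a‖ + ‖b‖))]
    have : 2 * (‖a‖ + ‖b‖) ≤ 4 * M := by linarith
    gcongr
  rw [h1]
  refine (norm_add_le _ _).trans ?_
  rw [norm_mul, norm_mul, Complex.norm_real, Complex.norm_real, Real.norm_eq_abs, Real.norm_eq_abs]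
  have h5 : |2 * (‖a‖ ^ 2 - 1)| * ‖a - b‖ ≤ (2 * M ^ 2 + 2) * ‖a - b‖ := by gcongr
  have h6 : |2 * (‖a‖ ^ 2 - ‖b‖ ^ 2)| * ‖b‖ ≤ 4 * M * ‖a - b‖ * M := by gcongr
  linarith

theorem norm_nonlinearity_le {M : ℝ} {a : ℂ} (ha : ‖a‖ ≤ M) :
    ‖nonlinearity a‖ ≤ (6 * M ^ 2 + 2) * M := by
  have h0 : nonlinearity 0 = 0 := by simp [nonlinearity]
  have := norm_nonlinearity_sub_le ha (b := 0) (by simpa using (norm_nonneg a).trans ha)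
  rw [h0, sub_zero, sub_zero] at this
  exact this.trans (by gcongr)

theorem UniformlyBoundedOn.nonlinearity {I : Set ℝ} {F : ℝ → ℝ → ℂ} {M : ℝ}
    (hb : UniformlyBoundedOn I F M) :
    UniformlyBoundedOn I (fun t x => nonlinearity (F t x)) ((6 * M ^ 2 + 2) * M) where
  aestronglyMeasurable t ht :=
    continuous_nonlinearity.comp_aestronglyMeasurable (hb.aestronglyMeasurable t ht)
  ae_norm_le t ht := (hb.ae_norm_le t ht).mono fun _ hx => norm_nonlinearity_le hx

theorem L2locContinuousOn.nonlinearity {I : Set ℝ} {F : ℝ → ℝ → ℂ} {M : ℝ}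
    (hF : L2locContinuousOn I F) (hb : UniformlyBoundedOn I F M) :
    L2locContinuousOn I (fun t x => nonlinearity (F t x)) := by
  intro K hK t₀ ht₀
  have hlim := ENNReal.Tendsto.const_mul (a := ENNReal.ofReal (6 * M ^ 2 + 2))
    (hF K hK t₀ ht₀) (Or.inr ENNReal.ofReal_ne_top)
  rw [mul_zero] at hlim
  refine tendsto_of_tendsto_of_tendsto_of_le_of_le' tendsto_const_nhds hlim
    (Eventually.of_forall fun _ => zero_le) ?_
  filter_upwards [eventually_mem_nhdsWithin] with t ht
  refine eLpNorm_le_mul_eLpNorm_of_ae_le_mul ?_ 2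
  filter_upwards [ae_restrict_of_ae (hb.ae_norm_le t ht),
    ae_restrict_of_ae (hb.ae_norm_le t₀ ht₀)] with x hx hx₀
  exact norm_nonlinearity_sub_le hx hx₀

theorem ContinuousL2loc.l2locContinuousOn {I : Opens ℝ} {q : ℝ → Wave}
    (hc : ContinuousL2loc I q) : L2locContinuousOn I (fun t => q t) := by
  intro K hK t₀ ht₀
  refine ((hc K hK).2 t₀ ht₀).congr fun t => eLpNorm_congr_ae (ae_restrict_of_ae ?_)
  exact AEEqFun.coeFn_sub _ _

/-- An essential bound for almost every time extends to every time by `L²_loc` continuity. -/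
theorem L2locContinuousOn.uniformlyBoundedOn {I : Set ℝ} (hI : IsOpen I) {F : ℝ → ℝ → ℂ} {M : ℝ}
    (hF : L2locContinuousOn I F) (hm : ∀ t ∈ I, AEStronglyMeasurable (F t) volume)
    (hb : ∀ᵐ t ∂(volume.restrict I), ∀ᵐ x, ‖F t x‖ ≤ M) : UniformlyBoundedOn I F M := by
  refine ⟨hm, fun t ht => ?_⟩
  rw [ae_restrict_iff' hI.measurableSet] at hb
  -- A set of full measure in the open set `I` is dense there, so good times accumulate at `t`.
  have hfreq : ∃ᶠ s in 𝓝[I] t, ∀ᵐ x, ‖F s x‖ ≤ M := by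
    rw [hI.nhdsWithin_eq ht, frequently_nhds_iff]
    intro U htU hU
    obtain ⟨s, hs, hs'⟩ := (Measure.dense_of_ae hb).inter_open_nonempty _
      (hU.inter hI) ⟨t, htU, ht⟩
    exact ⟨s, hs.1, hs' hs.2⟩
  have hK : ∀ n : ℕ, ∀ᵐ x ∂(volume.restrict (Metric.closedBall (0 : ℝ) n)), ‖F t x‖ ≤ M := by
    intro n
    set μ := volume.restrict (Metric.closedBall (0 : ℝ) n)
    -- The excess of `‖F t x‖` over `M` is at most `‖F t x - F s x‖` for every good time `s`. Its
    -- `L²` norm on the ball is therefore below quantities that tend to zero.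
    set h : ℝ → ℝ := fun x => max (‖F t x‖ - M) 0
    have hhm : AEStronglyMeasurable h μ := by
      have := (hm t ht).norm.restrict (s := Metric.closedBall (0 : ℝ) n)
      exact (this.sub aestronglyMeasurable_const).sup aestronglyMeasurable_const
    have hlim := hF (Metric.closedBall 0 n) (isCompact_closedBall _ _) t ht
    have h0 : eLpNorm h 2 μ = 0 := by
      by_contra hne
      obtain ⟨s, hs1, hs2⟩ :=
        (hfreq.and_eventually (hlim.eventually (gt_mem_nhds (pos_iff_ne_zero.2 hne)))).exists
      refine absurd hs2 (not_lt.2 ?_)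
      refine eLpNorm_mono_ae ?_
      filter_upwards [ae_restrict_of_ae hs1] with x hx
      rw [Real.norm_of_nonneg (le_max_right _ _)]
      refine max_le ?_ (norm_nonneg _)
      have := norm_sub_norm_le (F t x) (F s x)
      rw [norm_sub_rev] at this
      linarith
    rw [eLpNorm_eq_zero_iff hhm (by norm_num)] at h0
    filter_upwards [h0] with x hx
    have : ‖F t x‖ - M ≤ 0 := (le_max_left _ _).trans_eq hx
    linarith
  have hU : (⋃ n : ℕ, Metric.closedBall (0 : ℝ) n) = Set.univ := Metric.iUnion_closedBall_nat 0
  have := (ae_restrict_iUnion_iff _ _).2 hK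
  rwa [hU, Measure.restrict_univ] at this

theorem L2locContinuousOn.sub {I : Set ℝ} {F G : ℝ → ℝ → ℂ} (hF : L2locContinuousOn I F)
    (hG : L2locContinuousOn I G) (hFm : ∀ t ∈ I, AEStronglyMeasurable (F t) volume)
    (hGm : ∀ t ∈ I, AEStronglyMeasurable (G t) volume) :
    L2locContinuousOn I (fun t x => F t x - G t x) := by
  intro K hK t₀ ht₀
  have hlim := (hF K hK t₀ ht₀).add (hG K hK t₀ ht₀)
  rw [add_zero] at hlim
  refine tendsto_of_tendsto_of_tendsto_of_le_of_le' tendsto_const_nhds hlim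
    (Eventually.of_forall fun _ => zero_le) ?_
  filter_upwards [eventually_mem_nhdsWithin] with t ht
  refine (eLpNorm_congr_ae (Eventually.of_forall fun x => ?_)).trans_le
    (eLpNorm_sub_le ((hFm t ht).sub (hFm t₀ ht₀)).restrict
      ((hGm t ht).sub (hGm t₀ ht₀)).restrict one_le_two)
  simp only [Pi.sub_apply]
  ring

theorem ContinuousL2loc.uniformlyBoundedOn {I : Opens ℝ} {q : ℝ → Wave} {M : ℝ≥0}
    (hc : ContinuousL2loc I q)
    (hb : ∀ᵐ t ∂(volume.restrict (I : Set ℝ)), eLpNorm (q t) ∞ volume ≤ M) :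
    UniformlyBoundedOn I (fun t => q t) M := by
  refine hc.l2locContinuousOn.uniformlyBoundedOn I.isOpen
    (fun t _ => (q t).aestronglyMeasurable) (hb.mono fun s hs => ?_)
  rw [eLpNorm_exponent_top] at hs
  filter_upwards [ae_le_eLpNormEssSup (f := q s)] with x hx
  have h1 := hx.trans hs
  rw [← ofReal_norm, ← ENNReal.ofReal_coe_nnreal] at h1
  exact (ENNReal.ofReal_le_ofReal_iff M.2).1 h1

/-! ### From the distributional equation to differential equations for mollifications. -/

theorem integrableOn_mul_of_tsupport_subset {X : Type*} [TopologicalSpace X] [MeasurableSpace X]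
    [OpensMeasurableSpace X] [T2Space X] [SecondCountableTopology X]
    {μ : Measure X} {S : Set X} (hS : MeasurableSet S) {u φ : X → ℂ}
    (hu : LocallyIntegrableOn u S μ) (hφ : Continuous φ) (hc : HasCompactSupport φ)
    (hs : tsupport φ ⊆ S) : IntegrableOn (fun p => u p * φ p) S μ := by
  obtain ⟨C, hC⟩ := hφ.bounded_above_of_compact_support hc
  have h1 : IntegrableOn (fun p => u p * φ p) (tsupport φ) μ :=
    (hu.integrableOn_compact_subset hs hc).mul_bdd hφ.aestronglyMeasurable
      (Eventually.of_forall hC)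
  refine h1.of_forall_sdiff_eq_zero hS fun p hp => ?_
  rw [image_eq_zero_of_notMem_tsupport hp.2, mul_zero]

/-- The slice form of the weak formulation: the equation tested against products. -/
theorem SolvesGPWeakly.integral_slice_eq_zero {I : Opens ℝ} {u : ℝ × ℝ → ℂ}
    (hu : SolvesGPWeakly I u) {θ : ℝ → ℝ} (hθ : ContDiff ℝ ∞ θ) (hθc : HasCompactSupport θ)
    (hθs : tsupport θ ⊆ I) {κ : ℝ → ℂ} (hκ : ContDiff ℝ ∞ κ) (hκc : HasCompactSupport κ) :
    ∫ t in (I : Set ℝ), ∫ y, (u (t, y) * (-Complex.I * (deriv θ t * κ y)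
      + θ t * deriv (deriv κ) y) - nonlinearity (u (t, y)) * (θ t * κ y)) = 0 := by
  have hmeas : MeasurableSet (slab I : Set (ℝ × ℝ)) := (slab I).isOpen.measurableSet
  have hsupp : ∀ (a : ℝ → ℝ) (b : ℝ → ℂ), tsupport a ⊆ tsupport θ → tsupport b ⊆ tsupport κ →
      ∀ p ∉ tsupport θ ×ˢ tsupport κ, (a p.1 : ℂ) * b p.2 = 0 := by
    intro a b ha hb p hp
    rw [Set.mem_prod, not_and_or] at hp
    rcases hp with h | h
    · rw [image_eq_zero_of_notMem_tsupport fun h' => h (ha h')]; simp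
    · rw [image_eq_zero_of_notMem_tsupport fun h' => h (hb h')]; simp
  have hK : IsCompact (tsupport θ ×ˢ tsupport κ) := IsCompact.prod hθc hκc
  have hKs : tsupport θ ×ˢ tsupport κ ⊆ (slab I : Set (ℝ × ℝ)) :=
    Set.prod_mono hθs (Set.subset_univ _)
  have hcs : ∀ (a : ℝ → ℝ) (b : ℝ → ℂ), tsupport a ⊆ tsupport θ → tsupport b ⊆ tsupport κ →
      HasCompactSupport (fun p : ℝ × ℝ => (a p.1 : ℂ) * b p.2) := fun a b ha hb =>
    HasCompactSupport.intro hK (hsupp a b ha hb)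
  have hts : ∀ (a : ℝ → ℝ) (b : ℝ → ℂ), tsupport a ⊆ tsupport θ → tsupport b ⊆ tsupport κ →
      tsupport (fun p : ℝ × ℝ => (a p.1 : ℂ) * b p.2) ⊆ slab I := fun a b ha hb =>
    (closure_minimal (fun p hp => by
      by_contra h
      exact hp (hsupp a b ha hb p h)) hK.isClosed).trans hKs
  have hθ' : tsupport (deriv θ) ⊆ tsupport θ := tsupport_deriv_subset
  have hκ'' : tsupport (deriv (deriv κ)) ⊆ tsupport κ :=
    tsupport_deriv_subset.trans tsupport_deriv_subset
  have hθ'c : Continuous (deriv θ) := hθ.continuous_deriv (by simp)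
  have hκ''c : Continuous (deriv (deriv κ)) :=
    (contDiff_infty_iff_deriv.1 hκ).2.continuous_deriv (by simp)
  have hi : ∀ (f : ℝ × ℝ → ℂ) (a : ℝ → ℝ) (b : ℝ → ℂ), tsupport a ⊆ tsupport θ →
      tsupport b ⊆ tsupport κ → Continuous a → Continuous b →
      LocallyIntegrableOn f (slab I : Set (ℝ × ℝ)) volume →
      IntegrableOn (fun p => f p * ((a p.1 : ℂ) * b p.2)) (slab I : Set (ℝ × ℝ)) volume :=
    fun f a b ha hb hac hbc hf => integrableOn_mul_of_tsupport_subset hmeas hf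
      (by fun_prop) (hcs a b ha hb) (hts a b ha hb)
  have h := hu.2.2 ⟨fun p => (θ p.1 : ℂ) * κ p.2,
    (Complex.ofRealCLM.contDiff.comp (hθ.comp contDiff_fst)).mul (hκ.comp contDiff_snd),
    hcs θ κ subset_rfl subset_rfl, hts θ κ subset_rfl subset_rfl⟩
  replace h : ∫ p in (slab I : Set (ℝ × ℝ)),
      (u p * (-Complex.I * deriv (fun s => (θ s : ℂ) * κ p.2) p.1
          + iteratedDeriv 2 (fun y => (θ p.1 : ℂ) * κ y) p.2)
        - 2 * ((‖u p‖ : ℂ) ^ 2 - 1) * u p * (θ p.1 * κ p.2)) = 0 := h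
  have hd1 : ∀ p : ℝ × ℝ, deriv (fun s => (θ s : ℂ) * κ p.2) p.1 = ((deriv θ p.1 : ℝ) : ℂ) * κ p.2 :=
    fun p => ((hθ.differentiable (by simp) p.1).hasDerivAt.ofReal_comp.mul_const _).deriv
  have hd2 : ∀ p : ℝ × ℝ, iteratedDeriv 2 (fun y => (θ p.1 : ℂ) * κ y) p.2
      = θ p.1 * deriv (deriv κ) p.2 := fun p => by
    rw [iteratedDeriv_succ, iteratedDeriv_one]
    simp
  simp_rw [hd1, hd2] at h
  have hint : IntegrableOn (fun p : ℝ × ℝ => u p * (-Complex.I * (deriv θ p.1 * κ p.2)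
      + θ p.1 * deriv (deriv κ) p.2) - nonlinearity (u p) * (θ p.1 * κ p.2))
      (slab I : Set (ℝ × ℝ)) volume := by
    have i1 := (hi u (deriv θ) κ hθ' subset_rfl hθ'c hκ.continuous hu.1).const_mul (-Complex.I)
    have i2 := hi u θ (deriv (deriv κ)) subset_rfl hκ'' hθ.continuous hκ''c hu.1
    have i3 := hi (fun p => nonlinearity (u p)) θ κ subset_rfl subset_rfl hθ.continuous
      hκ.continuous hu.2.1
    refine ((i1.add i2).sub i3).congr (Eventually.of_forall fun p => ?_)
    simp only [Pi.add_apply, Pi.sub_apply]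
    ring
  have hprod : (volume.restrict (slab I : Set (ℝ × ℝ)))
      = (volume.restrict (I : Set ℝ)).prod volume := by
    rw [← Measure.restrict_univ (μ := (volume : Measure ℝ)), Measure.restrict_restrict_of_subset
      (Set.subset_univ _), Measure.prod_restrict, ← Measure.volume_eq_prod]
    rfl
  rw [IntegrableOn, hprod] at hint
  rw [hprod] at h
  rw [← h, ← integral_prod _ hint]
  rfl

/-- Mollifications of a distributional solution are classically differentiable in time. -/
theorem IsDistributionalSolution.hasDerivAt_conv {I : Opens ℝ} (hI : (I : Set ℝ).OrdConnected)
    {q : ℝ → Wave} {M : ℝ} (hs : IsDistributionalSolution I q)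
    (hc : L2locContinuousOn I (fun t => q t)) (hb : UniformlyBoundedOn I (fun t => q t) M)
    {k : ℝ → ℂ} (hk : ContDiff ℝ ∞ k) (hkc : HasCompactSupport k) (x : ℝ) {t : ℝ} (ht : t ∈ I) :
    HasDerivAt (fun s => conv (q s) k x) (Complex.I * (conv (q t) (deriv (deriv k)) x
      - conv (fun y => nonlinearity (q t y)) k x)) t := by
  obtain ⟨u, huq, hu⟩ := hs
  have hk'' : Continuous (deriv (deriv k)) :=
    (contDiff_infty_iff_deriv.1 hk).2.continuous_deriv (by simp)
  have hca := continuousOn_conv_of_L2locContinuousOn hc hb hk.continuous hkc x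
  have hcb1 := continuousOn_conv_of_L2locContinuousOn hc hb hk'' hkc.deriv.deriv x
  have hcb2 := continuousOn_conv_of_L2locContinuousOn (hc.nonlinearity hb) hb.nonlinearity
    hk.continuous hkc x
  have hcb : ContinuousOn (fun s => Complex.I * (conv (q s) (deriv (deriv k)) x
      - conv (fun y => nonlinearity (q s y)) k x)) I :=
    continuousOn_const.mul (hcb1.sub hcb2)
  refine hasDerivAt_of_weakDeriv hI I.isOpen hca hcb (fun θ hθ hθc hθs => ?_) ht
  have hθ'c : Continuous (deriv θ) := hθ.continuous_deriv (by simp)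
  have hθ's : tsupport (deriv θ) ⊆ I := tsupport_deriv_subset.trans hθs
  have h0 := hu.integral_slice_eq_zero hθ hθc hθs (κ := fun y => k (x - y))
    (hk.comp (contDiff_const.sub contDiff_id)) (hkc.comp_homeomorph (Homeomorph.subLeft x))
  -- Reflection changes the sign of each derivative, so two derivatives restore it.
  have hd : deriv (deriv fun y => k (x - y)) = fun y => deriv (deriv k) (x - y) := by
    have h1 : (deriv fun y => k (x - y)) = fun y => -deriv k (x - y) :=
      funext fun y => deriv_comp_const_sub _ _ _
    rw [h1]
    funext y
    rw [deriv.fun_neg, deriv_comp_const_sub, neg_neg]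
  rw [hd] at h0
  have i1 := integrable_smul_of_tsupport_subset I.isOpen hθ'c hθc.deriv hθ's hca
  have i2 := integrable_smul_of_tsupport_subset I.isOpen hθ.continuous hθc hθs hcb
  -- The factor `-I` brings the claimed weak derivative identity to the form of the tested equation,
  -- since `-I * I = 1`. It is cancelled at the end.
  have h2 : ∫ s in (I : Set ℝ), -Complex.I * (deriv θ s • conv (q s) k x
      + θ s • (Complex.I * (conv (q s) (deriv (deriv k)) x
      - conv (fun y => nonlinearity (q s y)) k x))) = 0 := by
    rw [← h0]
    refine integral_congr_ae ?_
    filter_upwards [huq, ae_restrict_mem I.isOpen.measurableSet] with s hsq hsI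
    have l1 := hb.locallyIntegrable hsI
    have l2 := hb.nonlinearity.locallyIntegrable hsI
    have j1 := (integrable_mul_comp_sub_left l1 hk.continuous hkc x).const_mul
      (-Complex.I * deriv θ s)
    have j2 := (integrable_mul_comp_sub_left l1 hk'' hkc.deriv.deriv x).const_mul (θ s : ℂ)
    have j3 := (integrable_mul_comp_sub_left l2 hk.continuous hkc x).const_mul (θ s : ℂ)
    have h3 : ∫ y, (u (s, y) * (-Complex.I * (deriv θ s * k (x - y))
        + θ s * deriv (deriv k) (x - y)) - nonlinearity (u (s, y)) * (θ s * k (x - y)))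
        = ∫ y, (-Complex.I * deriv θ s * (q s y * k (x - y))
          + θ s * (q s y * deriv (deriv k) (x - y))
          - θ s * (nonlinearity (q s y) * k (x - y))) := by
      refine integral_congr_ae ?_
      filter_upwards [hsq] with y hy
      rw [hy]
      ring
    have j12 : Integrable fun y => -Complex.I * deriv θ s * (q s y * k (x - y))
        + θ s * (q s y * deriv (deriv k) (x - y)) := j1.add j2
    rw [h3, integral_sub j12 j3, integral_add j1 j2]
    simp_rw [integral_const_mul]
    simp only [Complex.real_smul]
    unfold conv
    linear_combination (- θ s * ((∫ y, q s y * deriv (deriv k) (x - y))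
      - ∫ y, nonlinearity (q s y) * k (x - y))) * Complex.I_mul_I
  rw [integral_const_mul, setIntegral_eq_integral_of_forall_compl_eq_zero, integral_add i1 i2]
    at h2
  · have h4 := (mul_eq_zero.1 h2).resolve_left (by simp)
    exact eq_neg_of_add_eq_zero_left h4
  · intro s hs
    rw [image_eq_zero_of_notMem_tsupport fun h => hs (hθ's h),
      image_eq_zero_of_notMem_tsupport fun h => hs (hθs h)]
    simp

/-! ### The spatial weight. -/

/-- A slowly decaying integrable weight of width `1 / δ`. -/
noncomputable def weight (δ x : ℝ) : ℝ := (1 + (δ * x) ^ 2)⁻¹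

section weight

variable {δ : ℝ}

theorem weight_pos (δ x : ℝ) : 0 < weight δ x := by
  unfold weight
  positivity

theorem weight_le_one (δ x : ℝ) : weight δ x ≤ 1 :=
  inv_le_one_of_one_le₀ (by nlinarith [sq_nonneg (δ * x)])

theorem weight_anti {δ' : ℝ} (h0 : 0 ≤ δ) (h : δ ≤ δ') (x : ℝ) : weight δ' x ≤ weight δ x := by
  unfold weight
  rw [mul_pow, mul_pow]
  gcongr

theorem continuous_weight (δ : ℝ) : Continuous (weight δ) := by
  unfold weight
  exact Continuous.inv₀ (by fun_prop) fun x => by positivity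

theorem integrable_weight (hδ : 0 < δ) : Integrable (weight δ) :=
  integrable_inv_one_add_sq.comp_mul_left' hδ.ne'

theorem integral_weight (hδ : 0 < δ) : ∫ x, weight δ x = Real.pi / δ := by
  have := Measure.integral_comp_mul_left (fun x : ℝ => (1 + x ^ 2)⁻¹) δ
  rw [integral_univ_inv_one_add_sq, abs_of_pos (inv_pos.2 hδ)] at this
  rw [div_eq_inv_mul]
  exact this

/-- The derivative of `weight δ`. -/
noncomputable def weightDeriv (δ x : ℝ) : ℝ := -(2 * (δ * x) * δ) / (1 + (δ * x) ^ 2) ^ 2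

theorem hasDerivAt_weight (δ x : ℝ) : HasDerivAt (weight δ) (weightDeriv δ x) x := by
  have h1 : HasDerivAt (fun x => 1 + (δ * x) ^ 2) (2 * (δ * x) * δ) x := by
    have := (((hasDerivAt_id x).const_mul δ).pow 2).const_add 1
    simpa using this
  exact h1.inv (by positivity)

theorem continuous_weightDeriv (δ : ℝ) : Continuous (weightDeriv δ) := by
  unfold weightDeriv
  exact Continuous.div (by fun_prop) (by fun_prop) fun x => by positivity

/-- This is `2|y| ≤ 1 + y²` with `y = δx`. The factor `δ` is what makes the boundary-free commutator
with `∂ₓₓ` small. -/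
theorem abs_weightDeriv_le (hδ : 0 < δ) (x : ℝ) : |weightDeriv δ x| ≤ δ * weight δ x := by
  unfold weightDeriv weight
  have h1 : 0 < 1 + (δ * x) ^ 2 := by positivity
  rw [abs_div, abs_neg, abs_mul, abs_of_pos hδ, abs_mul, abs_two, abs_of_pos (pow_pos h1 2),
    ← div_eq_mul_inv, div_le_div_iff₀ (pow_pos h1 2) h1]
  have h2 : 2 * |δ * x| ≤ 1 + (δ * x) ^ 2 := by
    rw [← sq_abs]
    nlinarith [sq_nonneg (|δ * x| - 1)]
  calc 2 * |δ * x| * δ * (1 + (δ * x) ^ 2)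
      ≤ (1 + (δ * x) ^ 2) * δ * (1 + (δ * x) ^ 2) := by gcongr
    _ = δ * (1 + (δ * x) ^ 2) ^ 2 := by ring

theorem integrable_weight_mul (hδ : 0 < δ) {f : ℝ → ℝ} (hf : Continuous f) {C : ℝ}
    (hC : ∀ x, |f x| ≤ C) : Integrable fun x => weight δ x * f x :=
  (integrable_weight hδ).mul_bdd hf.aestronglyMeasurable (Eventually.of_forall hC)

theorem integrable_weightDeriv_mul (hδ : 0 < δ) {f : ℝ → ℝ} (hf : Continuous f) {C : ℝ}
    (hC : ∀ x, |f x| ≤ C) : Integrable fun x => weightDeriv δ x * f x := by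
  refine Integrable.mul_bdd ?_ hf.aestronglyMeasurable (Eventually.of_forall hC)
  refine ((integrable_weight hδ).const_mul δ).mono' (continuous_weightDeriv δ).aestronglyMeasurable
    (Eventually.of_forall fun x => abs_weightDeriv_le hδ x)

/-- Cauchy–Schwarz, with `∫ χ² ≤ ∫ χ = π/δ` because `χ ≤ 1`. The growth `δ^(-1/2)` is beaten by the
factor `δ` from `abs_weightDeriv_le`. -/
theorem integral_weight_mul_norm_conv_le (hδ : 0 < δ) (φ : ContDiffBump (0 : ℝ)) {g : Wave}
    (hgl : LocallyIntegrable g volume) {G : ℝ≥0} (hG : eLpNorm g 2 volume ≤ G) :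
    ∫ x, weight δ x * ‖conv g (bumpKernel φ) x‖ ≤ √(Real.pi / δ) * G := by
  have hk := (contDiff_bumpKernel φ).continuous
  have hcont := continuous_conv hgl hk (hasCompactSupport_bumpKernel φ)
  rw [integral_eq_lintegral_of_nonneg_ae
    (Eventually.of_forall fun x => mul_nonneg (weight_pos δ x).le (norm_nonneg _))
    ((continuous_weight δ).mul hcont.norm).aestronglyMeasurable]
  refine ENNReal.toReal_le_of_le_ofReal (by positivity) ?_
  have h := lintegral_mul_conv_le (c := fun x => ENNReal.ofReal (weight δ x))
    (continuous_weight δ).measurable.ennreal_ofReal (AEEqFun.stronglyMeasurable g).measurable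
    hk.measurable
  rw [lintegral_enorm_bumpKernel, one_mul] at h
  refine (lintegral_congr fun x => ?_).trans_le (h.trans ?_)
  · rw [ENNReal.ofReal_mul (weight_pos δ x).le, ofReal_norm]
  · rw [ENNReal.ofReal_mul (Real.sqrt_nonneg _), ENNReal.ofReal_coe_nnreal, Real.sqrt_eq_rpow,
      ← ENNReal.ofReal_rpow_of_nonneg (by positivity) (by norm_num), ← integral_weight hδ,
      ofReal_integral_eq_lintegral_ofReal (integrable_weight hδ)
        (Eventually.of_forall fun x => (weight_pos δ x).le)]
    gcongr with x
    have : ENNReal.ofReal (weight δ x) ≤ 1 := ENNReal.ofReal_le_one.2 (weight_le_one δ x)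
    rw [ENNReal.rpow_two, sq]
    exact mul_le_of_le_one_left zero_le this

end weight

/-! ### The weighted energy estimate and Gronwall's inequality. -/

theorem inner_I_mul_self (z : ℂ) : inner ℝ z (Complex.I * z) = 0 := by
  rw [Complex.inner]
  simp
  ring

theorem abs_inner_le {z w : ℂ} {a b : ℝ} (hz : ‖z‖ ≤ a) (hw : ‖w‖ ≤ b) : |inner ℝ z w| ≤ a * b :=
  (abs_real_inner_le_norm z w).trans
    (mul_le_mul hz hw (norm_nonneg _) ((norm_nonneg _).trans hz))

/-- The weighted energy identity at a fixed time, with the nonlinearity estimated pointwise. -/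
theorem abs_integral_weight_inner_le {δ : ℝ} (hδ : 0 < δ) {w w' w'' F : ℝ → ℂ}
    {A B C D L h : ℝ} (hL : 0 ≤ L) (hh : 0 ≤ h)
    (hw : ∀ x, HasDerivAt w (w' x) x) (hw' : ∀ x, HasDerivAt w' (w'' x) x)
    (hc : Continuous w'') (hF : Continuous F) (hA : ∀ x, ‖w x‖ ≤ A) (hB : ∀ x, ‖w' x‖ ≤ B)
    (hC : ∀ x, ‖w'' x‖ ≤ C) (hFb : ∀ᵐ x, ‖F x‖ ≤ L * (‖w x‖ + h))
    (hD : ∫ x, weight δ x * ‖w' x‖ ≤ D) :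
    |∫ x, weight δ x * (2 * inner ℝ (w x) (Complex.I * (w'' x - F x)))|
      ≤ 2 * L * (∫ x, weight δ x * ‖w x‖ ^ 2)
        + (2 * δ * A * D + 2 * L * h * A * (Real.pi / δ)) := by
  have hwc : Continuous w := continuous_iff_continuousAt.2 fun x => (hw x).continuousAt
  have hw'c : Continuous w' := continuous_iff_continuousAt.2 fun x => (hw' x).continuousAt
  have hA0 : 0 ≤ A := (norm_nonneg _).trans (hA 0)
  have nI : ∀ z : ℂ, ‖Complex.I * z‖ = ‖z‖ := fun z => by simp
  have c1 : Continuous fun x => inner ℝ (w x) (Complex.I * w'' x) := by fun_prop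
  have c2 : Continuous fun x => inner ℝ (w x) (Complex.I * w' x) := by fun_prop
  have b1 : ∀ x, |inner ℝ (w x) (Complex.I * w'' x)| ≤ A * C := fun x =>
    abs_inner_le (hA x) ((nI _).trans_le (hC x))
  have b2 : ∀ x, |inner ℝ (w x) (Complex.I * w' x)| ≤ A * B := fun x =>
    abs_inner_le (hA x) ((nI _).trans_le (hB x))
  have i1 := integrable_weight_mul hδ c1 b1
  have i2 := integrable_weightDeriv_mul hδ c2 b2
  have i3 := integrable_weight_mul hδ c2 b2
  have isq : Integrable fun x => weight δ x * ‖w x‖ ^ 2 :=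
    integrable_weight_mul hδ (by fun_prop) (C := A ^ 2) fun x => by
      rw [abs_of_nonneg (by positivity)]
      gcongr
      exact hA x
  have iw' : Integrable fun x => weight δ x * ‖w' x‖ :=
    integrable_weight_mul hδ (by fun_prop) (C := B) fun x => by
      rw [abs_norm]
      exact hB x
  -- Differentiating `χ ⟨w, i w'⟩` also produces `χ ⟨w', i w'⟩`, which vanishes. Integrability of
  -- the product replaces any boundary terms.
  have hparts : ∫ x, (weightDeriv δ x * inner ℝ (w x) (Complex.I * w' x)
      + weight δ x * inner ℝ (w x) (Complex.I * w'' x)) = 0 := by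
    refine integral_eq_zero_of_hasDerivAt_of_integrable
      (f := fun x => weight δ x * inner ℝ (w x) (Complex.I * w' x)) (fun x => ?_) (i2.add i1) i3
    have h1 := (hw x).inner ℝ ((hw' x).const_mul Complex.I)
    rw [inner_I_mul_self, add_zero] at h1
    exact (hasDerivAt_weight δ x).mul h1
  rw [integral_add i2 i1] at hparts
  have hbF : ∀ᵐ x, ‖weight δ x * inner ℝ (w x) (Complex.I * F x)‖
      ≤ L * (weight δ x * ‖w x‖ ^ 2) + L * h * A * weight δ x := by
    filter_upwards [hFb] with x hx
    rw [norm_mul, Real.norm_of_nonneg (weight_pos δ x).le, Real.norm_eq_abs]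
    have h1 := abs_inner_le (z := w x) le_rfl ((nI (F x)).trans_le hx)
    have h2 : L * h * ‖w x‖ ≤ L * h * A := by
      gcongr
      exact hA x
    calc weight δ x * |inner ℝ (w x) (Complex.I * F x)|
        ≤ weight δ x * (L * ‖w x‖ ^ 2 + L * h * A) := by
          refine mul_le_mul_of_nonneg_left ?_ (weight_pos δ x).le
          linarith
      _ = _ := by ring
  have iF0 : Integrable fun x => L * (weight δ x * ‖w x‖ ^ 2) + L * h * A * weight δ x :=
    (isq.const_mul L).add ((integrable_weight hδ).const_mul _)
  have iF : Integrable fun x => weight δ x * inner ℝ (w x) (Complex.I * F x) :=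
    iF0.mono' ((continuous_weight δ).mul (by fun_prop)).aestronglyMeasurable hbF
  have hFint : |∫ x, weight δ x * inner ℝ (w x) (Complex.I * F x)|
      ≤ L * (∫ x, weight δ x * ‖w x‖ ^ 2) + L * h * A * (Real.pi / δ) := by
    refine (norm_integral_le_of_norm_le iF0 hbF).trans_eq ?_
    rw [integral_add (isq.const_mul L) ((integrable_weight hδ).const_mul _), integral_const_mul,
      integral_const_mul, integral_weight hδ]
  have hDint : |∫ x, weightDeriv δ x * inner ℝ (w x) (Complex.I * w' x)| ≤ δ * A * D := by
    rw [← Real.norm_eq_abs]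
    refine (norm_integral_le_of_norm_le (iw'.const_mul (δ * A))
      (Eventually.of_forall fun x => ?_)).trans ?_
    · rw [norm_mul, Real.norm_eq_abs, Real.norm_eq_abs]
      calc _ ≤ (δ * weight δ x) * (A * ‖w' x‖) :=
            mul_le_mul (abs_weightDeriv_le hδ x) (abs_inner_le (hA x) (nI (w' x)).le) (abs_nonneg _)
              (mul_nonneg hδ.le (weight_pos δ x).le)
        _ = _ := by ring
    · rw [integral_const_mul]
      gcongr
  have hsplit : ∀ x, weight δ x * (2 * inner ℝ (w x) (Complex.I * (w'' x - F x)))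
      = 2 * (weight δ x * inner ℝ (w x) (Complex.I * w'' x)
        - weight δ x * inner ℝ (w x) (Complex.I * F x)) := fun x => by
    rw [mul_sub, inner_sub_right]
    ring
  simp_rw [hsplit]
  rw [integral_const_mul, integral_sub i1 iF]
  rw [abs_le] at hDint hFint ⊢
  constructor <;> linarith [hDint.1, hDint.2, hFint.1, hFint.2]

/-- Differentiation of the weighted `L²` norm with respect to a parameter. -/
theorem hasDerivAt_integral_weight_norm_sq {I : Set ℝ} (hI : IsOpen I) {δ : ℝ} (hδ : 0 < δ)
    {W V : ℝ → ℝ → ℂ} {A B : ℝ} (hd : ∀ t ∈ I, ∀ x, HasDerivAt (fun s => W s x) (V t x) t)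
    (hW : ∀ t ∈ I, Continuous (W t)) (hV : ∀ t ∈ I, Continuous (V t))
    (hA : ∀ t ∈ I, ∀ x, ‖W t x‖ ≤ A) (hB : ∀ t ∈ I, ∀ x, ‖V t x‖ ≤ B) {t : ℝ} (ht : t ∈ I) :
    HasDerivAt (fun s => ∫ x, weight δ x * ‖W s x‖ ^ 2)
      (∫ x, weight δ x * (2 * inner ℝ (W t x) (V t x))) t := by
  refine (hasDerivAt_integral_of_dominated_loc_of_deriv_le (μ := volume)
    (F := fun s x => weight δ x * ‖W s x‖ ^ 2)
    (F' := fun s x => weight δ x * (2 * inner ℝ (W s x) (V s x)))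
    (bound := fun x => weight δ x * (2 * (A * B))) (hI.mem_nhds ht) ?_ ?_ ?_ ?_ ?_ ?_).2
  · filter_upwards [hI.mem_nhds ht] with s hs
    have := hW s hs
    exact ((continuous_weight δ).mul (by fun_prop)).aestronglyMeasurable
  · have := hW t ht
    refine integrable_weight_mul hδ (by fun_prop) (C := A ^ 2) fun x => ?_
    rw [abs_of_nonneg (by positivity)]
    gcongr
    exact hA t ht x
  · have := hW t ht
    have := hV t ht
    exact ((continuous_weight δ).mul (by fun_prop)).aestronglyMeasurable
  · refine Eventually.of_forall fun x s hs => ?_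
    rw [norm_mul, norm_mul, Real.norm_two, Real.norm_of_nonneg (weight_pos δ x).le]
    have := (weight_pos δ x).le
    gcongr
    exact abs_inner_le (hA s hs x) (hB s hs x)
  · exact (integrable_weight hδ).mul_const _
  · exact Eventually.of_forall fun x s hs => ((hd s hs x).norm_sq).const_mul _

/-- Needed because the energy inequality is first proved only at almost every time; continuity of
its left side carries it to all times. -/
theorem continuousOn_integral_weight_inner {I : Set ℝ} {δ : ℝ} (hδ : 0 < δ)
    {W V : ℝ → ℝ → ℂ} {A B : ℝ} (hWt : ∀ x, ContinuousOn (fun s => W s x) I)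
    (hVt : ∀ x, ContinuousOn (fun s => V s x) I)
    (hW : ∀ t ∈ I, Continuous (W t)) (hV : ∀ t ∈ I, Continuous (V t))
    (hA : ∀ t ∈ I, ∀ x, ‖W t x‖ ≤ A) (hB : ∀ t ∈ I, ∀ x, ‖V t x‖ ≤ B) :
    ContinuousOn (fun t => ∫ x, weight δ x * (2 * inner ℝ (W t x) (V t x))) I := by
  refine continuousOn_of_dominated (bound := fun x => weight δ x * (2 * (A * B))) ?_ ?_ ?_ ?_
  · intro t ht
    have := hW t ht
    have := hV t ht
    exact ((continuous_weight δ).mul (by fun_prop)).aestronglyMeasurable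
  · refine fun s hs => Eventually.of_forall fun x => ?_
    rw [norm_mul, norm_mul, Real.norm_two, Real.norm_of_nonneg (weight_pos δ x).le]
    have := (weight_pos δ x).le
    gcongr
    exact abs_inner_le (hA s hs x) (hB s hs x)
  · exact (integrable_weight hδ).mul_const _
  · exact Eventually.of_forall fun x =>
      continuousOn_const.mul (continuousOn_const.mul ((hWt x).inner (hVt x)))

/-- A two-sided Gronwall inequality on an interval around the initial time. -/
theorem le_of_abs_deriv_le {I : Set ℝ} (hI : I.OrdConnected) (h0 : (0 : ℝ) ∈ I)
    {E E' : ℝ → ℝ} {K c : ℝ} (hK : 0 < K) (hE : ∀ t ∈ I, HasDerivAt E (E' t) t) (hE0 : E 0 = 0)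
    (hb : ∀ t ∈ I, |E' t| ≤ K * |E t| + c) {t : ℝ} (ht : t ∈ I) :
    |E t| ≤ c / K * (Real.exp (K * |t|) - 1) := by
  rcases le_total 0 t with h | h
  · have hsub : Set.Icc 0 t ⊆ I := hI.out h0 ht
    have := norm_le_gronwallBound_of_norm_deriv_right_le (f := E) (f' := E') (δ := 0) (K := K)
      (ε := c) (a := 0) (b := t)
      (fun s hs => (hE s (hsub hs)).continuousAt.continuousWithinAt)
      (fun s hs => (hE s (hsub ⟨hs.1, hs.2.le⟩)).hasDerivWithinAt) (by simp [hE0])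
      (fun s hs => hb s (hsub ⟨hs.1, hs.2.le⟩)) t ⟨h, le_rfl⟩
    rw [gronwallBound_of_K_ne_0 hK.ne'] at this
    simpa [abs_of_nonneg h] using this
  -- Negative times reduce to positive ones by reflection.
  · have hsub : ∀ s ∈ Set.Icc 0 (-t), -s ∈ I := fun s hs =>
      hI.out ht h0 ⟨by linarith [hs.2], by linarith [hs.1]⟩
    have hd : ∀ s ∈ Set.Icc 0 (-t), HasDerivAt (fun s => E (-s)) (-E' (-s)) s := fun s hs => by
      simpa [Function.comp_def] using (hE (-s) (hsub s hs)).comp s (hasDerivAt_neg s)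
    have := norm_le_gronwallBound_of_norm_deriv_right_le (f := fun s => E (-s))
      (f' := fun s => -E' (-s)) (δ := 0) (K := K) (ε := c) (a := 0) (b := -t)
      (fun s hs => (hd s hs).continuousAt.continuousWithinAt)
      (fun s hs => (hd s ⟨hs.1, hs.2.le⟩).hasDerivWithinAt) (by simp [hE0])
      (fun s hs => by
        rw [norm_neg]
        exact hb _ (hsub s ⟨hs.1, hs.2.le⟩)) (-t) ⟨by linarith, le_rfl⟩
    rw [gronwallBound_of_K_ne_0 hK.ne'] at this
    simpa [abs_of_nonpos h] using this

/-- Averaging against a bump kernel changes a function by at most its local oscillation. -/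
theorem norm_conv_bumpKernel_sub_le (φ : ContDiffBump (0 : ℝ)) {f : ℝ → ℂ}
    (hf : LocallyIntegrable f) {x r : ℝ} {z : ℂ}
    (h : ∀ᵐ y, |x - y| < φ.rOut → ‖f y - z‖ ≤ r) : ‖conv f (bumpKernel φ) x - z‖ ≤ r := by
  have hk := (contDiff_bumpKernel φ).continuous
  have hc := hasCompactSupport_bumpKernel φ
  have hi : Integrable (bumpKernel φ) := hk.integrable_of_hasCompactSupport hc
  have h1 : ∫ y, bumpKernel φ (x - y) = 1 := by
    rw [integral_sub_left_eq_self (bumpKernel φ) volume x]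
    unfold bumpKernel
    rw [integral_complex_ofReal, φ.integral_normed, Complex.ofReal_one]
  have h2 : conv f (bumpKernel φ) x - z = ∫ y, (f y - z) * bumpKernel φ (x - y) := by
    simp_rw [sub_mul]
    rw [integral_sub (integrable_mul_comp_sub_left hf hk hc x) ((hi.comp_sub_left x).const_mul z),
      integral_const_mul, h1, mul_one]
    rfl
  have h3 : ∫ y, r * ‖bumpKernel φ (x - y)‖ = r := by
    rw [integral_const_mul, integral_sub_left_eq_self (fun y => ‖bumpKernel φ y‖) volume x,
      integral_norm_bumpKernel, mul_one]
  rw [h2, ← h3]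
  refine norm_integral_le_of_norm_le ((hi.comp_sub_left x).norm.const_mul r) ?_
  filter_upwards [h] with y hy
  rw [norm_mul]
  rcases lt_or_ge |x - y| φ.rOut with h | h
  · exact mul_le_mul_of_nonneg_right (hy h) (norm_nonneg _)
  · rw [bumpKernel_eq_zero φ h]
    simp

/-! ### The energy inequality for the mollified difference of two solutions. -/

/-- A bounded solution together with `Ḣ¹` bounds at almost every time. -/
structure BoundedSolution (I : Opens ℝ) (q : ℝ → Wave) (M : ℝ≥0) : Prop where
  l2loc : L2locContinuousOn I (fun t => q t)
  bounded : UniformlyBoundedOn I (fun t => q t) M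
  solution : IsDistributionalSolution I q
  weakDeriv : ∀ᵐ t ∂(volume.restrict (I : Set ℝ)),
    ∃ g : Wave, HasWeakDeriv (q t) g ∧ eLpNorm g 2 volume ≤ M

theorem BoundedSolution.of_le {I : Opens ℝ} {q : ℝ → Wave} {M M' : ℝ≥0} (hM : M < M')
    (hc : ContinuousL2loc I q) (hs : IsDistributionalSolution I q)
    (hb : ∀ᵐ t ∂(volume.restrict (I : Set ℝ)),
      eLpNorm (q t) ∞ volume ≤ M ∧ hDotOneSeminorm (q t) ≤ M) : BoundedSolution I q M' where
  l2loc := hc.l2locContinuousOn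
  bounded := hc.uniformlyBoundedOn (hb.mono fun t ht =>
    ht.1.trans (ENNReal.coe_le_coe.2 hM.le))
  solution := hs
  weakDeriv := hb.mono fun t ht => by
    have h1 : hDotOneSeminorm (q t) < M' := ht.2.trans_lt (ENNReal.coe_lt_coe.2 hM)
    unfold hDotOneSeminorm at h1
    obtain ⟨g, hg⟩ := iInf_lt_iff.1 h1
    obtain ⟨hg1, hg2⟩ := iInf_lt_iff.1 hg
    exact ⟨g, hg1, hg2.le⟩

/-- Comparison of mollified differences with the differences themselves, for bounded functions in
`Ḣ¹`. -/
theorem ae_mollified_sub_le {f₁ f₂ g₁ g₂ : Wave} {M : ℝ≥0} (h₁ : HasWeakDeriv f₁ g₁)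
    (h₂ : HasWeakDeriv f₂ g₂) (hg₁ : eLpNorm g₁ 2 volume ≤ M) (hg₂ : eLpNorm g₂ 2 volume ≤ M)
    (hM₁ : ∀ᵐ x, ‖f₁ x‖ ≤ M) (hM₂ : ∀ᵐ x, ‖f₂ x‖ ≤ M) (φ : ContDiffBump (0 : ℝ)) :
    ∀ᵐ x, ‖(conv f₁ (bumpKernel φ) x - conv f₂ (bumpKernel φ) x) - (f₁ x - f₂ x)‖
        ≤ 2 * M * √φ.rOut ∧
      ‖conv (fun y => nonlinearity (f₁ y)) (bumpKernel φ) x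
          - conv (fun y => nonlinearity (f₂ y)) (bumpKernel φ) x‖
        ≤ (6 * (M : ℝ) ^ 2 + 2) * (‖f₁ x - f₂ x‖ + 2 * M * √φ.rOut) := by
  obtain ⟨s₁, hs₁, hs₁'⟩ := h₁.ae_norm_sub_le hg₁
  obtain ⟨s₂, hs₂, hs₂'⟩ := h₂.ae_norm_sub_le hg₂
  have hk := (contDiff_bumpKernel φ).continuous
  have hc := hasCompactSupport_bumpKernel φ
  have hN : ∀ f : Wave, (∀ᵐ x, ‖f x‖ ≤ M) → LocallyIntegrable fun y => nonlinearity (f y) :=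
    fun f hf => locallyIntegrable_of_ae_norm_le
      (continuous_nonlinearity.comp_aestronglyMeasurable f.aestronglyMeasurable)
      (hf.mono fun _ hx => norm_nonlinearity_le hx)
  filter_upwards [hs₁, hs₂] with x hx₁ hx₂
  have hosc : ∀ᵐ y, |x - y| < φ.rOut →
      ‖(f₁ y - f₂ y) - (f₁ x - f₂ x)‖ ≤ 2 * M * √φ.rOut := by
    filter_upwards [hs₁, hs₂] with y hy₁ hy₂ hxy
    have e1 := hs₁' x hx₁ y hy₁
    have e2 := hs₂' x hx₂ y hy₂
    have e3 : M * √|x - y| ≤ M * √φ.rOut := by gcongr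
    calc ‖(f₁ y - f₂ y) - (f₁ x - f₂ x)‖ = ‖(f₂ x - f₂ y) - (f₁ x - f₁ y)‖ := by
          congr 1; ring
      _ ≤ ‖f₂ x - f₂ y‖ + ‖f₁ x - f₁ y‖ := norm_sub_le _ _
      _ ≤ _ := by linarith
  constructor
  · rw [← conv_sub_left h₁.1 h₂.1 hk hc]
    exact norm_conv_bumpKernel_sub_le φ (h₁.1.sub h₂.1) hosc
  -- Here the averaging lemma is used with `z = 0`: the Lipschitz bound applies inside the average,
  -- and then only the oscillation of `f₁ - f₂` matters.
  · rw [← conv_sub_left (hN f₁ hM₁) (hN f₂ hM₂) hk hc,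
      ← sub_zero (conv _ _ _)]
    refine norm_conv_bumpKernel_sub_le φ ((hN f₁ hM₁).sub (hN f₂ hM₂)) ?_
    filter_upwards [hosc, hM₁, hM₂] with y hy hy₁ hy₂ hxy
    rw [sub_zero]
    refine (norm_nonlinearity_sub_le hy₁ hy₂).trans ?_
    gcongr
    have := norm_le_norm_add_norm_sub' (f₁ y - f₂ y) (f₁ x - f₂ x)
    linarith [hy hxy]

/-- The source term in the Gronwall inequality for the mollified weighted energy. -/
noncomputable def energyError (M : ℝ≥0) (δ ε : ℝ) : ℝ :=
  -- The last two terms of `abs_integral_weight_inner_le` with `A = 2M`, `D = 2√(π/δ) M` and `h = 2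
  -- (2M√ε)`. One `2M√ε` in `h` comes from averaging the nonlinearities, the other from replacing
  -- `q₁ - q₂` by its mollification.
  2 * δ * (2 * M) * (2 * (√(Real.pi / δ) * M))
    + 2 * (6 * (M : ℝ) ^ 2 + 2) * (2 * (2 * M * √ε)) * (2 * M) * (Real.pi / δ)

theorem le_of_ae_le_of_continuousOn {I : Set ℝ} (hI : IsOpen I) {f g : ℝ → ℝ}
    (hf : ContinuousOn f I) (hg : ContinuousOn g I)
    (h : ∀ᵐ t ∂(volume.restrict I), f t ≤ g t) {t : ℝ} (ht : t ∈ I) : f t ≤ g t := by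
  rw [ae_restrict_iff' hI.measurableSet] at h
  have hcl := (Measure.dense_of_ae h).open_subset_closure_inter hI ht
  exact ContinuousWithinAt.closure_le hcl ((hf t ht).mono Set.inter_subset_left)
    ((hg t ht).mono Set.inter_subset_left) fun s hs => hs.2 hs.1

/-- The weighted energy of the mollified difference of two solutions with equal initial data. -/
theorem integral_weight_mollified_sub_le {I : Opens ℝ} (hI : (I : Set ℝ).OrdConnected)
    (h0 : (0 : ℝ) ∈ I) {q₁ q₂ : ℝ → Wave} {M : ℝ≥0} (h₁ : BoundedSolution I q₁ M)
    (h₂ : BoundedSolution I q₂ M) (hi : q₁ 0 = q₂ 0) {δ : ℝ} (hδ : 0 < δ)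
    (φ : ContDiffBump (0 : ℝ)) {t : ℝ} (ht : t ∈ I) :
    ∫ x, weight δ x * ‖conv (q₁ t) (bumpKernel φ) x - conv (q₂ t) (bumpKernel φ) x‖ ^ 2
      ≤ energyError M δ φ.rOut / (2 * (6 * (M : ℝ) ^ 2 + 2))
        * (Real.exp (2 * (6 * (M : ℝ) ^ 2 + 2) * |t|) - 1) := by
  set k := bumpKernel φ
  set L : ℝ := 6 * (M : ℝ) ^ 2 + 2
  have hL : 0 < L := by positivity
  have hk : ContDiff ℝ ∞ k := contDiff_bumpKernel φ
  have hkc : HasCompactSupport k := hasCompactSupport_bumpKernel φ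
  have hk1 : ContDiff ℝ ∞ (deriv k) := (contDiff_infty_iff_deriv.1 hk).2
  have hk2 : ContDiff ℝ ∞ (deriv (deriv k)) := (contDiff_infty_iff_deriv.1 hk1).2
  set W : ℝ → ℝ → ℂ := fun s x => conv (q₁ s) k x - conv (q₂ s) k x
  set W₁ : ℝ → ℝ → ℂ := fun s x => conv (q₁ s) (deriv k) x - conv (q₂ s) (deriv k) x
  set W₂ : ℝ → ℝ → ℂ := fun s x =>
    conv (q₁ s) (deriv (deriv k)) x - conv (q₂ s) (deriv (deriv k)) x
  set F : ℝ → ℝ → ℂ := fun s x => conv (fun y => nonlinearity (q₁ s y)) k x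
    - conv (fun y => nonlinearity (q₂ s y)) k x
  set V : ℝ → ℝ → ℂ := fun s x => Complex.I * (W₂ s x - F s x)
  have l₁ : ∀ s ∈ I, LocallyIntegrable (q₁ s) volume := fun s hs => h₁.bounded.locallyIntegrable hs
  have l₂ : ∀ s ∈ I, LocallyIntegrable (q₂ s) volume := fun s hs => h₂.bounded.locallyIntegrable hs
  have cW : ∀ s ∈ I, Continuous (W s) := fun s hs =>
    (continuous_conv (l₁ s hs) hk.continuous hkc).sub (continuous_conv (l₂ s hs) hk.continuous hkc)
  have cW₂ : ∀ s ∈ I, Continuous (W₂ s) := fun s hs =>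
    (continuous_conv (l₁ s hs) hk2.continuous hkc.deriv.deriv).sub
      (continuous_conv (l₂ s hs) hk2.continuous hkc.deriv.deriv)
  have cF : ∀ s ∈ I, Continuous (F s) := fun s hs =>
    (continuous_conv (h₁.bounded.nonlinearity.locallyIntegrable hs) hk.continuous hkc).sub
      (continuous_conv (h₂.bounded.nonlinearity.locallyIntegrable hs) hk.continuous hkc)
  have cV : ∀ s ∈ I, Continuous (V s) := fun s hs =>
    continuous_const.mul ((cW₂ s hs).sub (cF s hs))
  have bconv : ∀ κ : ℝ → ℂ, Continuous κ → HasCompactSupport κ → ∀ s ∈ I, ∀ x,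
      ‖conv (q₁ s) κ x - conv (q₂ s) κ x‖ ≤ 2 * M * ∫ z, ‖κ z‖ := fun κ hκ hκc s hs x => by
    have e1 := norm_conv_le (h₁.bounded.ae_norm_le s hs) hκ hκc x
    have e2 := norm_conv_le (h₂.bounded.ae_norm_le s hs) hκ hκc x
    linarith [norm_sub_le (conv (q₁ s) κ x) (conv (q₂ s) κ x)]
  have bW : ∀ s ∈ I, ∀ x, ‖W s x‖ ≤ 2 * M := fun s hs x => by
    have := bconv k hk.continuous hkc s hs x
    rwa [integral_norm_bumpKernel, mul_one] at this
  have bW₁ := bconv (deriv k) hk1.continuous hkc.deriv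
  have bW₂ := bconv (deriv (deriv k)) hk2.continuous hkc.deriv.deriv
  have bF : ∀ s ∈ I, ∀ x, ‖F s x‖ ≤ L * M + L * M := fun s hs x => by
    have e1 := norm_conv_le (h₁.bounded.nonlinearity.ae_norm_le s hs) hk.continuous hkc x
    have e2 := norm_conv_le (h₂.bounded.nonlinearity.ae_norm_le s hs) hk.continuous hkc x
    rw [integral_norm_bumpKernel, mul_one] at e1 e2
    exact (norm_sub_le _ _).trans (add_le_add e1 e2)
  have bV : ∀ s ∈ I, ∀ x, ‖V s x‖ ≤ 2 * M * (∫ z, ‖deriv (deriv k) z‖) + (L * M + L * M) :=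
    fun s hs x => by
      rw [norm_mul, Complex.norm_I, one_mul]
      exact (norm_sub_le _ _).trans (add_le_add (bW₂ s hs x) (bF s hs x))
  have dW : ∀ s ∈ I, ∀ x, HasDerivAt (fun r => W r x) (V s x) s := fun s hs x => by
    have e1 := h₁.solution.hasDerivAt_conv hI h₁.l2loc h₁.bounded hk hkc x hs
    have e2 := h₂.solution.hasDerivAt_conv hI h₂.l2loc h₂.bounded hk hkc x hs
    refine (e1.sub e2).congr_deriv ?_
    simp only [V, W₂, F]
    ring
  have tW : ∀ x, ContinuousOn (fun s => W s x) I := fun x s hs =>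
    (dW s hs x).continuousAt.continuousWithinAt
  have tV : ∀ x, ContinuousOn (fun s => V s x) I := fun x => by
    have a1 := continuousOn_conv_of_L2locContinuousOn h₁.l2loc h₁.bounded hk2.continuous
      hkc.deriv.deriv x
    have a2 := continuousOn_conv_of_L2locContinuousOn h₂.l2loc h₂.bounded hk2.continuous
      hkc.deriv.deriv x
    have a3 := continuousOn_conv_of_L2locContinuousOn (h₁.l2loc.nonlinearity h₁.bounded)
      h₁.bounded.nonlinearity hk.continuous hkc x
    have a4 := continuousOn_conv_of_L2locContinuousOn (h₂.l2loc.nonlinearity h₂.bounded)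
      h₂.bounded.nonlinearity hk.continuous hkc x
    exact continuousOn_const.mul ((a1.sub a2).sub (a3.sub a4))
  have dE : ∀ s ∈ I, HasDerivAt (fun s => ∫ x, weight δ x * ‖W s x‖ ^ 2)
      (∫ x, weight δ x * (2 * inner ℝ (W s x) (V s x))) s := fun s hs =>
    hasDerivAt_integral_weight_norm_sq I.isOpen hδ dW cW cV bW bV hs
  have cE' := continuousOn_integral_weight_inner hδ tW tV cW cV bW bV
  have cE : ContinuousOn (fun s => ∫ x, weight δ x * ‖W s x‖ ^ 2) I := fun s hs =>
    (dE s hs).continuousAt.continuousWithinAt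
  have key : ∀ s ∈ I, |∫ x, weight δ x * (2 * inner ℝ (W s x) (V s x))|
      ≤ 2 * L * (∫ x, weight δ x * ‖W s x‖ ^ 2) + energyError M δ φ.rOut := by
    intro s hs
    -- The weak derivatives are available only at almost every time, but both sides are continuous
    -- in time.
    refine le_of_ae_le_of_continuousOn I.isOpen cE'.abs
      ((continuousOn_const.mul cE).add continuousOn_const) ?_ hs
    filter_upwards [h₁.weakDeriv, h₂.weakDeriv, ae_restrict_mem I.isOpen.measurableSet]
      with r ⟨g₁, hg₁, hg₁'⟩ ⟨g₂, hg₂, hg₂'⟩ hr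
    refine abs_integral_weight_inner_le hδ hL.le (by positivity)
      (fun x => (hasDerivAt_conv (l₁ r hr) hk hkc x).sub (hasDerivAt_conv (l₂ r hr) hk hkc x))
      (fun x => (hasDerivAt_conv (l₁ r hr) hk1 hkc.deriv x).sub
        (hasDerivAt_conv (l₂ r hr) hk1 hkc.deriv x))
      (cW₂ r hr) (cF r hr) (bW r hr) (bW₁ r hr) (bW₂ r hr) ?_ ?_
    · filter_upwards [ae_mollified_sub_le hg₁ hg₂ hg₁' hg₂' (h₁.bounded.ae_norm_le r hr)
        (h₂.bounded.ae_norm_le r hr) φ] with x ⟨hx1, hx2⟩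
      refine hx2.trans (mul_le_mul_of_nonneg_left ?_ hL.le)
      have := norm_le_norm_add_norm_sub' (q₁ r x - q₂ r x) (W r x)
      rw [norm_sub_rev _ (W r x)] at this
      have hx1' : ‖W r x - (q₁ r x - q₂ r x)‖ ≤ 2 * M * √φ.rOut := hx1
      linarith
    · have a1 := integral_weight_mul_norm_conv_le hδ φ hg₁.2.1 hg₁'
      have a2 := integral_weight_mul_norm_conv_le hδ φ hg₂.2.1 hg₂'
      have i : ∀ (q : ℝ → Wave) (g : Wave), UniformlyBoundedOn I (fun t => q t) M →
          HasWeakDeriv (q r) g → Integrable fun x => weight δ x * ‖conv g k x‖ := by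
        intro q g hq hg
        refine integrable_weight_mul hδ (continuous_conv hg.2.1 hk.continuous hkc).norm
          -- The function `g` is not known to be bounded, but `conv g k = conv (q r) (deriv k)` is.
          (C := M * ∫ z, ‖deriv k z‖) fun x => ?_
        rw [abs_norm, ← hg.conv_deriv hk hkc]
        exact norm_conv_le (hq.ae_norm_le r hr) hk1.continuous hkc.deriv x
      have i1 := i q₁ g₁ h₁.bounded hg₁
      have i2 := i q₂ g₂ h₂.bounded hg₂
      have iW : Integrable fun x => weight δ x * ‖W₁ r x‖ := by
        have c1 : Continuous (W₁ r) :=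
          (continuous_conv (l₁ r hr) hk1.continuous hkc.deriv).sub
            (continuous_conv (l₂ r hr) hk1.continuous hkc.deriv)
        refine integrable_weight_mul hδ c1.norm (C := 2 * M * ∫ z, ‖deriv k z‖) fun x => ?_
        rw [abs_norm]
        exact bW₁ r hr x
      calc ∫ x, weight δ x * ‖W₁ r x‖
          ≤ ∫ x, (weight δ x * ‖conv g₁ k x‖ + weight δ x * ‖conv g₂ k x‖) := by
            refine integral_mono iW (i1.add i2) fun x => ?_
            simp only [W₁]
            rw [hg₁.conv_deriv hk hkc, hg₂.conv_deriv hk hkc, ← mul_add]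
            exact mul_le_mul_of_nonneg_left (norm_sub_le _ _) (weight_pos δ x).le
        _ ≤ _ := by
            rw [integral_add i1 i2]
            linarith
  have hE0 : (fun s => ∫ x, weight δ x * ‖W s x‖ ^ 2) 0 = 0 := by
    simp [W, hi]
  refine (le_abs_self _).trans (le_of_abs_deriv_le hI h0 (by positivity : 0 < 2 * L) dE hE0
    (fun s hs => (key s hs).trans ?_) ht)
  gcongr
  exact le_abs_self _

/-! ### Removing the mollification and the weight. -/

/-- For `ε = δ⁴` the two errors are of sizes `√δ` and `√ε / δ = δ`. -/
theorem tendsto_energyError (M : ℝ≥0) :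
    Tendsto (fun δ : ℝ => energyError M δ (δ ^ 4)) (𝓝[>] 0) (𝓝 0) := by
  have h1 : Tendsto (fun δ : ℝ => 8 * (M : ℝ) ^ 2 * √(Real.pi * δ)
      + 16 * (6 * (M : ℝ) ^ 2 + 2) * (M : ℝ) ^ 2 * Real.pi * δ) (𝓝[>] 0) (𝓝 0) := by
    have : Continuous (fun δ : ℝ => 8 * (M : ℝ) ^ 2 * √(Real.pi * δ)
      + 16 * (6 * (M : ℝ) ^ 2 + 2) * (M : ℝ) ^ 2 * Real.pi * δ) := by fun_prop
    simpa using (this.tendsto 0).mono_left nhdsWithin_le_nhds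
  refine h1.congr' ?_
  filter_upwards [self_mem_nhdsWithin] with δ hδ
  have hδ : 0 < δ := hδ
  have e1 : √(δ ^ 4) = δ ^ 2 := by
    rw [show δ ^ 4 = (δ ^ 2) ^ 2 by ring]
    exact Real.sqrt_sq (by positivity)
  have e2 : √(Real.pi * δ) = δ * √(Real.pi / δ) := by
    rw [show Real.pi * δ = δ ^ 2 * (Real.pi / δ) by field_simp,
      Real.sqrt_mul (by positivity), Real.sqrt_sq hδ.le]
  rw [energyError, e1, e2]
  field_simp
  ring

/-- Two bounded solutions with equal initial data agree at every time at which both have square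
integrable weak derivatives. -/
theorem BoundedSolution.eq_of_hasWeakDeriv {I : Opens ℝ} (hI : (I : Set ℝ).OrdConnected)
    (h0 : (0 : ℝ) ∈ I) {q₁ q₂ : ℝ → Wave} {M : ℝ≥0} (h₁ : BoundedSolution I q₁ M)
    (h₂ : BoundedSolution I q₂ M) (hi : q₁ 0 = q₂ 0) {t : ℝ} (ht : t ∈ I) {g₁ g₂ : Wave}
    (hg₁ : HasWeakDeriv (q₁ t) g₁) (hg₂ : HasWeakDeriv (q₂ t) g₂)
    (hg₁' : eLpNorm g₁ 2 volume ≤ M) (hg₂' : eLpNorm g₂ 2 volume ≤ M) : q₁ t = q₂ t := by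
  set L : ℝ := 6 * (M : ℝ) ^ 2 + 2
  have hsm : AEStronglyMeasurable (fun x => ‖q₁ t x - q₂ t x‖ ^ 2) volume :=
    ((q₁ t).aestronglyMeasurable.sub (q₂ t).aestronglyMeasurable).norm.pow 2
  have hbd : ∀ᵐ x, ‖‖q₁ t x - q₂ t x‖ ^ 2‖ ≤ (2 * M : ℝ) ^ 2 := by
    filter_upwards [h₁.bounded.ae_norm_le t ht, h₂.bounded.ae_norm_le t ht] with x hx₁ hx₂
    rw [Real.norm_of_nonneg (by positivity)]
    gcongr
    linarith [norm_sub_le (q₁ t x) (q₂ t x)]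
  have hint : ∀ δ : ℝ, 0 < δ → Integrable fun x => weight δ x * ‖q₁ t x - q₂ t x‖ ^ 2 :=
    fun δ hδ => (integrable_weight hδ).mul_bdd hsm hbd
  -- The bound `(a + b)² ≤ 2a² + 2b²` doubles the mollified energy, and the squared Hölder error
  -- `8M²δ⁴` integrated against the weight gives `8M²δ⁴ · π/δ`.
  set R : ℝ → ℝ := fun δ => 2 * (energyError M δ (δ ^ 4) / (2 * L)
    * (Real.exp (2 * L * |t|) - 1)) + 8 * (M : ℝ) ^ 2 * Real.pi * δ ^ 3
  have hR : Tendsto R (𝓝[>] 0) (𝓝 0) := by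
    have a1 := (((tendsto_energyError M).div_const (2 * L)).mul_const
      (Real.exp (2 * L * |t|) - 1)).const_mul 2
    have a2 : Tendsto (fun δ : ℝ => 8 * (M : ℝ) ^ 2 * Real.pi * δ ^ 3) (𝓝[>] 0) (𝓝 0) := by
      have : Continuous fun δ : ℝ => 8 * (M : ℝ) ^ 2 * Real.pi * δ ^ 3 := by fun_prop
      simpa using (this.tendsto 0).mono_left nhdsWithin_le_nhds
    simpa using a1.add a2
  -- The left side keeps the fixed weight `weight 1`, which is below `weight δ` for `δ ≤ 1`, so that
  -- `δ → 0` can be taken on the right alone.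
  have hle : ∀ δ : ℝ, 0 < δ → δ ≤ 1 → ∫ x, weight 1 x * ‖q₁ t x - q₂ t x‖ ^ 2 ≤ R δ := by
    intro δ hδ hδ1
    let φ : ContDiffBump (0 : ℝ) := ⟨δ ^ 4 / 2, δ ^ 4, by positivity, half_lt_self (by positivity)⟩
    have hE := integral_weight_mollified_sub_le hI h0 h₁ h₂ hi hδ φ ht
    have hcont : Continuous fun x => conv (q₁ t) (bumpKernel φ) x - conv (q₂ t) (bumpKernel φ) x :=
      (continuous_conv hg₁.1 (contDiff_bumpKernel φ).continuous
        (hasCompactSupport_bumpKernel φ)).sub (continuous_conv hg₂.1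
          (contDiff_bumpKernel φ).continuous (hasCompactSupport_bumpKernel φ))
    have iE : Integrable fun x => weight δ x
        * ‖conv (q₁ t) (bumpKernel φ) x - conv (q₂ t) (bumpKernel φ) x‖ ^ 2 := by
      refine integrable_weight_mul hδ (hcont.norm.pow 2) (C := (M + M : ℝ) ^ 2) fun x => ?_
      rw [abs_of_nonneg (by positivity)]
      have e1 := norm_conv_le (h₁.bounded.ae_norm_le t ht) (contDiff_bumpKernel φ).continuous
        (hasCompactSupport_bumpKernel φ) x
      have e2 := norm_conv_le (h₂.bounded.ae_norm_le t ht) (contDiff_bumpKernel φ).continuous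
        (hasCompactSupport_bumpKernel φ) x
      rw [integral_norm_bumpKernel, mul_one] at e1 e2
      gcongr
      exact (norm_sub_le _ _).trans (add_le_add e1 e2)
    calc ∫ x, weight 1 x * ‖q₁ t x - q₂ t x‖ ^ 2
        ≤ ∫ x, (2 * (weight δ x
          * ‖conv (q₁ t) (bumpKernel φ) x - conv (q₂ t) (bumpKernel φ) x‖ ^ 2)
          + 8 * (M : ℝ) ^ 2 * δ ^ 4 * weight δ x) := by
          refine integral_mono_ae (hint 1 one_pos)
            ((iE.const_mul 2).add ((integrable_weight hδ).const_mul _)) ?_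
          filter_upwards [ae_mollified_sub_le hg₁ hg₂ hg₁' hg₂' (h₁.bounded.ae_norm_le t ht)
            (h₂.bounded.ae_norm_le t ht) φ] with x ⟨hx, _⟩
          set w := conv (q₁ t) (bumpKernel φ) x - conv (q₂ t) (bumpKernel φ) x
          have b1 : ‖q₁ t x - q₂ t x‖ ≤ ‖w‖ + 2 * M * √(δ ^ 4) := by
            have := norm_le_norm_add_norm_sub' (q₁ t x - q₂ t x) w
            rw [norm_sub_rev (q₁ t x - q₂ t x)] at this
            exact this.trans (by gcongr)
          have b2 : ‖q₁ t x - q₂ t x‖ ^ 2 ≤ 2 * ‖w‖ ^ 2 + 8 * (M : ℝ) ^ 2 * δ ^ 4 := by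
            have b3 : (2 * M * √(δ ^ 4)) ^ 2 = 4 * (M : ℝ) ^ 2 * δ ^ 4 := by
              rw [mul_pow, Real.sq_sqrt (by positivity)]
              ring
            have b4 : ‖q₁ t x - q₂ t x‖ ^ 2 ≤ (‖w‖ + 2 * M * √(δ ^ 4)) ^ 2 := by gcongr
            nlinarith [sq_nonneg (‖w‖ - 2 * M * √(δ ^ 4))]
          calc weight 1 x * ‖q₁ t x - q₂ t x‖ ^ 2
              ≤ weight δ x * (2 * ‖w‖ ^ 2 + 8 * (M : ℝ) ^ 2 * δ ^ 4) :=
                mul_le_mul (weight_anti hδ.le hδ1 x) b2 (by positivity) (weight_pos δ x).le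
            _ = _ := by ring
      _ ≤ R δ := by
          rw [integral_add (iE.const_mul 2) ((integrable_weight hδ).const_mul _),
            integral_const_mul, integral_const_mul, integral_weight hδ]
          refine add_le_add (mul_le_mul_of_nonneg_left hE zero_le_two) (le_of_eq ?_)
          field_simp
  have hzero : ∫ x, weight 1 x * ‖q₁ t x - q₂ t x‖ ^ 2 = 0 := by
    refine le_antisymm (ge_of_tendsto hR ?_)
      (integral_nonneg fun x => mul_nonneg (weight_pos 1 x).le (by positivity))
    filter_upwards [Ioc_mem_nhdsGT (zero_lt_one' ℝ)] with δ hδ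
    exact hle δ hδ.1 hδ.2
  rw [integral_eq_zero_iff_of_nonneg
    (fun x => mul_nonneg (weight_pos 1 x).le (by positivity)) (hint 1 one_pos)] at hzero
  refine AEEqFun.ext ?_
  filter_upwards [hzero] with x hx
  have := (mul_eq_zero.1 hx).resolve_left (weight_pos 1 x).ne'
  exact sub_eq_zero.1 (norm_eq_zero.1 (pow_eq_zero_iff two_ne_zero |>.1 this))

end GrossPitaevskii

theorem lemma3p1 (I : Opens ℝ) (hI : (I : Set ℝ).OrdConnected) (h0 : (0 : ℝ) ∈ I)
    (q₀ : GrossPitaevskii.Wave) (hq₀ : GrossPitaevskii.MemLinftyHDotOne q₀)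
    (q₁ q₂ : ℝ → GrossPitaevskii.Wave)
    (hc₁ : GrossPitaevskii.ContinuousL2loc I q₁) (hc₂ : GrossPitaevskii.ContinuousL2loc I q₂)
    (hb₁ : GrossPitaevskii.BoundedLinftyHDotOne I q₁)
    (hb₂ : GrossPitaevskii.BoundedLinftyHDotOne I q₂)
    (hs₁ : GrossPitaevskii.IsDistributionalSolution I q₁)
    (hs₂ : GrossPitaevskii.IsDistributionalSolution I q₂)
    (hi₁ : q₁ 0 = q₀) (hi₂ : q₂ 0 = q₀) :
    ∀ t ∈ I, q₁ t = q₂ t := by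
  obtain ⟨M₁, hM₁⟩ := hb₁
  obtain ⟨M₂, hM₂⟩ := hb₂
  -- The added `1` makes the bound on the infimum in `hDotOneSeminorm` strict, so an actual weak
  -- derivative with norm at most `M` exists.
  set M : ℝ≥0 := max M₁ M₂ + 1
  have h₁ : GrossPitaevskii.BoundedSolution I q₁ M := .of_le
    ((le_max_left M₁ M₂).trans_lt (lt_add_one _)) hc₁ hs₁ hM₁
  have h₂ : GrossPitaevskii.BoundedSolution I q₂ M := .of_le
    ((le_max_right M₁ M₂).trans_lt (lt_add_one _)) hc₂ hs₂ hM₂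
  have hae : ∀ᵐ t ∂(volume.restrict (I : Set ℝ)), q₁ t = q₂ t := by
    filter_upwards [h₁.weakDeriv, h₂.weakDeriv, ae_restrict_mem I.isOpen.measurableSet]
      with t ⟨g₁, hg₁, hg₁'⟩ ⟨g₂, hg₂, hg₂'⟩ ht
    exact GrossPitaevskii.BoundedSolution.eq_of_hasWeakDeriv hI h0 h₁ h₂ (hi₁.trans hi₂.symm) ht hg₁ hg₂ hg₁' hg₂'
  -- Equality at almost every time is the essential bound `0` on the difference, which `L²_loc`
  -- continuity extends to every time.
  have hF := (h₁.l2loc.sub h₂.l2loc (fun t _ => (q₁ t).aestronglyMeasurable)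
    fun t _ => (q₂ t).aestronglyMeasurable).uniformlyBoundedOn I.isOpen (M := 0)
    (fun t _ => (q₁ t).aestronglyMeasurable.sub (q₂ t).aestronglyMeasurable)
    (hae.mono fun t ht => by simp [ht])
  intro t ht
  refine AEEqFun.ext ?_
  filter_upwards [hF.ae_norm_le t ht] with x hx
  exact sub_eq_zero.1 (norm_le_zero_iff.1 hx)
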